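/- Fix a basis of the Lie algebra $\mathfrak{sl}_2(\mathbb R)$ and use it to identify $\mathfrak{sl}_2(\mathbb R)$ with $\mathbb R^3$, with the standard Euclidean norm and Lebesgue measure $m$. Let $\log$ be the inverse of $\exp:\mathfrak{sl}_2(\mathbb R)\to PSL_2(\mathbb R)$ on a neighbourhood of the identity. Fix a left-invariant Riemannian metric on $PSL_2(\mathbb R)$, with distance $d$, and let $\tilde m$ be the Haar measure on $PSL_2(\mathbb R)$ normalised so that $\frac{d\tilde m}{d(m\circ\log)}(\mathrm{Id})=1$. For a random variable $x$ in $PSL_2(\mathbb R)$ whose law is absolutely continuous with density $f$ with respect to $\tilde m$, let $H(x)=-\int f\log f\,d\tilde m$; we say that $x$ has finite entropy if $\int f|\log f|\,d\tilde m<\infty$. For $g_0\in PSL_2(\mathbb R)$ let $\mathrm{Var}_{g_0}[x]$ be the covariance matrix of $\log(g_0^{-1}x)$. For a random variable $y$ and a $\sigma(y)$-measurable random variable $g_0$, let $\mathrm{Tr}\,\mathrm{Var}_{g_0}[x\mid y](\omega)$ be $\mathrm{Tr}\,\mathrm{Var}_{g_0(\omega)}$ of the regular conditional distribution of $x$ given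 $y$ at $\omega$. **Theorem.** There is $\varepsilon_0>0$ such that for every $A>0$ there is a constant $C>0$, depending only on $A$ (and on the choices fixed above), with the following property. Let $g,s_1,s_2$ be independent random variables taking values in $PSL_2(\mathbb R)$. Suppose that $s_1$ and $s_2$ are absolutely continuous and have finite entropy, and that $gs_1$ and $gs_2$ have finite entropy. Put $$k:=H(gs_1)-H(s_1)-H(gs_2)+H(s_2),\qquad c:=\tfrac32\log\left(\tfrac23\pi e\,\mathrm{Tr}\,\mathrm{Var}_{\mathrm{Id}}[s_1]\right)-H(s_1),$$ and suppose that $k>0$. Suppose further that $0<\varepsilon\le\varepsilon_0$, that $d(\mathrm{Id},s_1)\le\varepsilon$ and $d(\mathrm{Id},s_2)\le\varepsilon$ almost surely, and that $\mathrm{Tr}\,\mathrm{Var}_{\mathrm{Id}}[s_1]\ge A\varepsilon^2$. Then $\mathrm{Tr}\,\mathrm{Var}_{gs_2}[g\mid gs_2]$ is integrable and $$\mathbb E\left[\mathrm{Tr}\,\mathrm{Var}_{gs_2}[g\mid gs_2]\right]\ \ge\ \tfrac23\,(k-c-C\varepsilon)\,\mathrm{Tr}\,\mathrm{Var}_{\mathrm{Id}}[s_1].$$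 -/

import Mathlib

open Matrix MeasureTheory ProbabilityTheory Filter Topology
open scoped MatrixGroups ENNReal

namespace PSLVariance

/-! ### Topology and Borel structure on `SL(2, ℝ)` and `PSL(2, ℝ)`

`PSL(2, ℝ)` carries the quotient topology, and the quotient of the Borel sigma-algebra of
`SL(2, ℝ)`, which is the Borel sigma-algebra of the quotient topology (`instBorelPSL` below). -/

instance instMeasurableSpaceSL : MeasurableSpace SL(2, ℝ) := borel _

instance instBorelSL : BorelSpace SL(2, ℝ) := ⟨rfl⟩

instance instPolishSL : PolishSpace SL(2, ℝ) := by
  have : PolishSpace (Matrix (Fin 2) (Fin 2) ℝ) :=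
    inferInstanceAs (PolishSpace (Fin 2 → Fin 2 → ℝ))
  exact (Matrix.SpecialLinearGroup.isClosedEmbedding_val (n := Fin 2) (R := ℝ)).polishSpace

instance instLocallyCompactSL : LocallyCompactSpace SL(2, ℝ) := by
  have : LocallyCompactSpace (Matrix (Fin 2) (Fin 2) ℝ) :=
    inferInstanceAs (LocallyCompactSpace (Fin 2 → Fin 2 → ℝ))
  exact (Matrix.SpecialLinearGroup.isClosedEmbedding_val
    (n := Fin 2) (R := ℝ)).locallyCompactSpace

instance instClosedCenterSL :
    IsClosed ((Subgroup.center SL(2, ℝ) : Subgroup SL(2, ℝ)) : Set SL(2, ℝ)) := by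
  have h : ((Subgroup.center SL(2, ℝ) : Subgroup SL(2, ℝ)) : Set SL(2, ℝ))
      = ⋂ h : SL(2, ℝ), {g | h * g = g * h} := by
    ext g
    simp [Subgroup.mem_center_iff]
  rw [h]
  exact isClosed_iInter fun h =>
    isClosed_eq (continuous_const.mul continuous_id) (continuous_id.mul continuous_const)

instance instBorelPSL : BorelSpace PSL(2, ℝ) := QuotientGroup.borelSpace

instance instLocallyCompactPSL : LocallyCompactSpace PSL(2, ℝ) := inferInstance

instance instSecondCountablePSL : SecondCountableTopology PSL(2, ℝ) :=
  QuotientGroup.isOpenQuotientMap_mk.isQuotientMap.secondCountableTopology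
    QuotientGroup.isOpenQuotientMap_mk.isOpenMap

instance instPolishPSL : PolishSpace PSL(2, ℝ) := by
  let : UniformSpace PSL(2, ℝ) := IsTopologicalGroup.rightUniformSpace PSL(2, ℝ)
  have : IsRightUniformGroup PSL(2, ℝ) := ⟨rfl⟩
  have : CompleteSpace PSL(2, ℝ) :=
    IsRightUniformGroup.completeSpace_of_weaklyLocallyCompactSpace
  have : (_root_.uniformity PSL(2, ℝ)).IsCountablyGenerated := comap.isCountablyGenerated _ _
  infer_instance

/-! ### The Lie algebra and the exponential map -/

/-- The Lie algebra of `PSL(2, ℝ)`: trace zero matrices. -/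
abbrev sl2 : Type := LieAlgebra.SpecialLinear.sl (Fin 2) ℝ

theorem sl2_trace (X : sl2) : (X : Matrix (Fin 2) (Fin 2) ℝ).trace = 0 := X.2

/-- By Cayley-Hamilton, `X² = - det X` for trace zero `X`. -/
theorem sl2_sq (X : sl2) :
    (X : Matrix (Fin 2) (Fin 2) ℝ) * X = (-(X : Matrix (Fin 2) (Fin 2) ℝ).det) • 1 := by
  have h := sl2_trace X
  rw [Matrix.trace_fin_two] at h
  have h' : (X : Matrix (Fin 2) (Fin 2) ℝ) 1 1 = - (X : Matrix (Fin 2) (Fin 2) ℝ) 0 0 := by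
    linarith
  ext i j
  fin_cases i <;> fin_cases j <;>
    simp [Matrix.mul_apply, Fin.sum_univ_two, Matrix.det_fin_two, h'] <;> ring

/-- If `M² = -d`, `c' = -d s`, `s' = c`, `c 0 = 1` and `s 0 = 0`, then `exp M = c 1 + s 1 • M`. -/
theorem exp_eq_of_deriv_aux {𝔸 : Type*} [NormedRing 𝔸] [NormedAlgebra ℝ 𝔸] [CompleteSpace 𝔸]
    (M : 𝔸) (d : ℝ) (hsq : M * M = (-d) • 1) (c s : ℝ → ℝ)
    (hc : ∀ t, HasDerivAt c (-d * s t) t)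
    (hs : ∀ t, HasDerivAt s (c t) t) (hc0 : c 0 = 1) (hs0 : s 0 = 0) :
    NormedSpace.exp M = c 1 • (1 : 𝔸) + s 1 • M := by
  let : NormedAlgebra ℚ 𝔸 := NormedAlgebra.restrictScalars ℚ ℝ 𝔸
  have hF : ∀ t : ℝ, HasDerivAt
      (fun t : ℝ => NormedSpace.exp (t • (-M)) * (c t • (1 : 𝔸) + s t • M)) 0 t := by
    intro t
    have h1 := hasDerivAt_exp_smul_const (𝕂 := ℝ) (-M) t
    have h2 := ((hc t).smul_const (1 : 𝔸)).add ((hs t).smul_const M)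
    have h3 := h1.mul h2
    refine h3.congr_deriv ?_
    have h0 : -M * (c t • (1 : 𝔸) + s t • M) + ((-d * s t) • (1 : 𝔸) + c t • M) = 0 := by
      rw [mul_add, mul_smul_comm, mul_smul_comm, mul_one, neg_mul, hsq]
      module
    simp only [Pi.add_apply]
    rw [mul_assoc, ← mul_add, h0, mul_zero]
  have hconst := is_const_of_deriv_eq_zero (fun t => (hF t).differentiableAt)
    (fun t => (hF t).deriv) 1 0
  simp only [one_smul, zero_smul, NormedSpace.exp_zero, hc0, hs0, add_zero, mul_one] at hconst
  have hinv : NormedSpace.exp M * NormedSpace.exp (-M) = 1 := by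
    rw [← NormedSpace.exp_add_of_commute (Commute.neg_right (Commute.refl M))]
    simp
  calc NormedSpace.exp M = NormedSpace.exp M * 1 := (mul_one _).symm
    _ = NormedSpace.exp M * (NormedSpace.exp (-M) * (c 1 • 1 + s 1 • M)) := by rw [hconst]
    _ = c 1 • 1 + s 1 • M := by rw [← mul_assoc, hinv, one_mul]

open scoped Matrix.Norms.Operator in
theorem exp_eq_of_deriv (X : sl2) (c s : ℝ → ℝ)
    (hc : ∀ t, HasDerivAt c (-(X : Matrix (Fin 2) (Fin 2) ℝ).det * s t) t)
    (hs : ∀ t, HasDerivAt s (c t) t) (hc0 : c 0 = 1) (hs0 : s 0 = 0) :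
    NormedSpace.exp (X : Matrix (Fin 2) (Fin 2) ℝ)
      = c 1 • (1 : Matrix (Fin 2) (Fin 2) ℝ) + s 1 • (X : Matrix (Fin 2) (Fin 2) ℝ) :=
  exp_eq_of_deriv_aux (X : Matrix (Fin 2) (Fin 2) ℝ) _ (sl2_sq X) c s hc hs hc0 hs0

/-- `cos √d`, continued analytically to negative `d`. -/
noncomputable def cosSqrt (d : ℝ) : ℝ := if 0 ≤ d then Real.cos √d else Real.cosh √(-d)

/-- `sin √d / √d`, continued analytically to all real `d`. -/
noncomputable def sincSqrt (d : ℝ) : ℝ :=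
  if 0 < d then Real.sin √d / √d else if d = 0 then 1 else Real.sinh √(-d) / √(-d)

theorem exp_sl2 (X : sl2) :
    NormedSpace.exp (X : Matrix (Fin 2) (Fin 2) ℝ)
      = cosSqrt (X : Matrix (Fin 2) (Fin 2) ℝ).det • (1 : Matrix (Fin 2) (Fin 2) ℝ)
        + sincSqrt (X : Matrix (Fin 2) (Fin 2) ℝ).det • (X : Matrix (Fin 2) (Fin 2) ℝ) := by
  set d := (X : Matrix (Fin 2) (Fin 2) ℝ).det with hd
  rcases lt_trichotomy d 0 with h | h | h
  · have hw : √(-d) ≠ 0 := (Real.sqrt_pos.2 (by linarith)).ne'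
    have hw2 : √(-d) * √(-d) = -d := Real.mul_self_sqrt (by linarith)
    have := exp_eq_of_deriv X (fun t => Real.cosh (t * √(-d)))
      (fun t => Real.sinh (t * √(-d)) / √(-d)) ?_ ?_ (by simp) (by simp)
    · simpa [cosSqrt, sincSqrt, h.not_ge, h.not_gt, h.ne] using this
    · intro t
      have := ((hasDerivAt_id t).mul_const √(-d)).cosh
      refine this.congr_deriv ?_
      rw [← hd]
      simp only [id]
      field_simp
      linear_combination (Real.sinh (t * √(-d))) * hw2
    · intro t
      have := (((hasDerivAt_id t).mul_const √(-d)).sinh).div_const √(-d)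
      refine this.congr_deriv ?_
      simp only [id]
      field_simp
  · have := exp_eq_of_deriv X (fun _ => 1) (fun t => t) ?_ ?_ rfl rfl
    · simpa [cosSqrt, sincSqrt, h] using this
    · intro t
      rw [← hd, h]
      simpa using hasDerivAt_const t (1 : ℝ)
    · intro t
      exact hasDerivAt_id t
  · have hw : √d ≠ 0 := (Real.sqrt_pos.2 h).ne'
    have hw2 : √d * √d = d := Real.mul_self_sqrt h.le
    have := exp_eq_of_deriv X (fun t => Real.cos (t * √d))
      (fun t => Real.sin (t * √d) / √d) ?_ ?_ (by simp) (by simp)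
    · simpa [cosSqrt, sincSqrt, h, h.le] using this
    · intro t
      have := ((hasDerivAt_id t).mul_const √d).cos
      refine this.congr_deriv ?_
      rw [← hd]
      simp only [id]
      field_simp
      linear_combination (-Real.sin (t * √d)) * hw2
    · intro t
      have := (((hasDerivAt_id t).mul_const √d).sin).div_const √d
      refine this.congr_deriv ?_
      simp only [id]
      field_simp

theorem cosSqrt_sq_add (d : ℝ) : cosSqrt d ^ 2 + d * sincSqrt d ^ 2 = 1 := by
  unfold cosSqrt sincSqrt
  rcases lt_trichotomy d 0 with h | h | h
  · have hw : √(-d) ≠ 0 := (Real.sqrt_pos.2 (by linarith)).ne'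
    have hw2 : √(-d) ^ 2 = -d := Real.sq_sqrt (by linarith)
    rw [if_neg h.not_ge, if_neg h.not_gt, if_neg h.ne, div_pow, hw2, Real.cosh_sq]
    have h' : d ≠ 0 := h.ne
    field_simp
    ring
  · simp [h]
  · have hw2 : √d ^ 2 = d := Real.sq_sqrt h.le
    rw [if_pos h.le, if_pos h, div_pow, hw2, mul_div_cancel₀ _ h.ne']
    exact Real.cos_sq_add_sin_sq _

theorem det_exp_sl2 (X : sl2) : (NormedSpace.exp (X : Matrix (Fin 2) (Fin 2) ℝ)).det = 1 := by
  have h := sl2_trace X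
  rw [Matrix.trace_fin_two] at h
  have key := cosSqrt_sq_add (X : Matrix (Fin 2) (Fin 2) ℝ).det
  rw [exp_sl2]
  set c := cosSqrt (X : Matrix (Fin 2) (Fin 2) ℝ).det
  set s := sincSqrt (X : Matrix (Fin 2) (Fin 2) ℝ).det
  rw [← key]
  simp only [Matrix.det_fin_two, Matrix.add_apply, Matrix.smul_apply, Matrix.one_apply_eq,
    smul_eq_mul, ne_eq, zero_ne_one, one_ne_zero, not_false_eq_true, Matrix.one_apply_ne]
  linear_combination (c * s) * h

/-- The exponential map `𝔰𝔩₂(ℝ) → PSL₂(ℝ)`. -/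
noncomputable def expPSL (X : sl2) : PSL(2, ℝ) :=
  QuotientGroup.mk
    (⟨NormedSpace.exp (X : Matrix (Fin 2) (Fin 2) ℝ), det_exp_sl2 X⟩ : SL(2, ℝ))

/-- An open neighbourhood of `0` in the Lie algebra on which `expPSL` is injective
(see `expPSL_injOn`). -/
def logTarget : Set sl2 := {X | (X : Matrix (Fin 2) (Fin 2) ℝ).det < (Real.pi / 2) ^ 2}

theorem cosSqrt_pos {d : ℝ} (hd : d < (Real.pi / 2) ^ 2) : 0 < cosSqrt d := by
  unfold cosSqrt
  split_ifs with h
  · have h1 : √d < Real.pi / 2 := (Real.sqrt_lt' (by positivity)).2 hd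
    exact Real.cos_pos_of_mem_Ioo ⟨by linarith [Real.sqrt_nonneg d, Real.pi_pos], h1⟩
  · exact Real.cosh_pos _

theorem sincSqrt_pos {d : ℝ} (hd : d < (Real.pi / 2) ^ 2) : 0 < sincSqrt d := by
  unfold sincSqrt
  split_ifs with h h'
  · have h1 : √d < Real.pi / 2 := (Real.sqrt_lt' (by positivity)).2 hd
    have h2 : 0 < √d := Real.sqrt_pos.2 h
    exact div_pos (Real.sin_pos_of_pos_of_lt_pi h2 (by linarith [Real.pi_pos])) h2
  · exact one_pos
  · have h2 : 0 < √(-d) := Real.sqrt_pos.2 (by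
      rcases lt_trichotomy d 0 with h3 | h3 | h3
      · linarith
      · exact absurd h3 h'
      · exact absurd h3 h)
    exact div_pos (Real.sinh_pos_iff.2 h2) h2

theorem cosSqrt_inj {d d' : ℝ} (hd : d < (Real.pi / 2) ^ 2) (hd' : d' < (Real.pi / 2) ^ 2)
    (h : cosSqrt d = cosSqrt d') : d = d' := by
  have key : ∀ x y : ℝ, x < 0 → 0 ≤ y → cosSqrt x ≠ cosSqrt y := by
    intro x y hx hy hxy
    unfold cosSqrt at hxy
    rw [if_neg hx.not_ge, if_pos hy] at hxy
    have h1 : 1 < Real.cosh √(-x) :=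
      Real.one_lt_cosh.2 (Real.sqrt_pos.2 (by linarith)).ne'
    linarith [Real.cos_le_one √y]
  rcases lt_or_ge d 0 with h1 | h1 <;> rcases lt_or_ge d' 0 with h2 | h2
  · unfold cosSqrt at h
    rw [if_neg h1.not_ge, if_neg h2.not_ge] at h
    have h3 := Real.cosh_le_cosh.1 h.le
    have h4 := Real.cosh_le_cosh.1 h.ge
    rw [abs_of_nonneg (Real.sqrt_nonneg _), abs_of_nonneg (Real.sqrt_nonneg _)] at h3 h4
    have h5 := (Real.sqrt_inj (by linarith) (by linarith)).1 (le_antisymm h3 h4)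
    linarith
  · exact absurd h (key d d' h1 h2)
  · exact absurd h.symm (key d' d h2 h1)
  · unfold cosSqrt at h
    rw [if_pos h1, if_pos h2] at h
    have h3 : √d < Real.pi / 2 := (Real.sqrt_lt' (by positivity)).2 hd
    have h4 : √d' < Real.pi / 2 := (Real.sqrt_lt' (by positivity)).2 hd'
    have h5 := Real.injOn_cos ⟨Real.sqrt_nonneg d, by linarith [Real.pi_pos]⟩
      ⟨Real.sqrt_nonneg d', by linarith [Real.pi_pos]⟩ h
    exact (Real.sqrt_inj h1 h2).1 h5

theorem trace_exp_sl2 (X : sl2) : (NormedSpace.exp (X : Matrix (Fin 2) (Fin 2) ℝ)).trace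
    = 2 * cosSqrt (X : Matrix (Fin 2) (Fin 2) ℝ).det := by
  rw [exp_sl2, Matrix.trace_add, Matrix.trace_smul, Matrix.trace_smul, sl2_trace]
  simp
  ring

theorem expPSL_injOn : Set.InjOn expPSL logTarget := by
  intro X hX Y hY hXY
  have h1 := QuotientGroup.eq.1 hXY
  obtain ⟨r, hr, hr'⟩ := Matrix.SpecialLinearGroup.mem_center_iff.1 h1
  have h2 : NormedSpace.exp (Y : Matrix (Fin 2) (Fin 2) ℝ)
      = r • NormedSpace.exp (X : Matrix (Fin 2) (Fin 2) ℝ) := by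
    set a : SL(2, ℝ) := ⟨NormedSpace.exp (X : Matrix (Fin 2) (Fin 2) ℝ), det_exp_sl2 X⟩ with ha
    set b : SL(2, ℝ) := ⟨NormedSpace.exp (Y : Matrix (Fin 2) (Fin 2) ℝ), det_exp_sl2 Y⟩ with hb
    have h3 : (b : Matrix (Fin 2) (Fin 2) ℝ)
        = (a : Matrix (Fin 2) (Fin 2) ℝ) * ((a⁻¹ * b : SL(2, ℝ)) : Matrix (Fin 2) (Fin 2) ℝ) := by
      rw [← Matrix.SpecialLinearGroup.coe_mul, mul_inv_cancel_left]
    rw [← hr'] at h3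
    change (b : Matrix (Fin 2) (Fin 2) ℝ) = r • (a : Matrix (Fin 2) (Fin 2) ℝ)
    rw [h3, Matrix.scalar_apply, ← Matrix.smul_one_eq_diagonal, mul_smul_comm, mul_one]
  have h3 := congrArg Matrix.trace h2
  rw [Matrix.trace_smul, trace_exp_sl2, trace_exp_sl2, smul_eq_mul] at h3
  have hpX := cosSqrt_pos hX
  have hpY := cosSqrt_pos hY
  have hr1 : r = 1 := by
    rw [Fintype.card_fin] at hr
    rcases mul_self_eq_one_iff.1 ((sq r).symm.trans hr) with h | h
    · exact h
    · rw [h] at h3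
      linarith
  rw [hr1] at h2 h3
  have hdet : (X : Matrix (Fin 2) (Fin 2) ℝ).det = (Y : Matrix (Fin 2) (Fin 2) ℝ).det :=
    cosSqrt_inj hX hY (by linarith)
  rw [one_smul, exp_sl2, exp_sl2, ← hdet] at h2
  have h4 := add_left_cancel h2
  have h5 := smul_right_injective _ (sincSqrt_pos hX).ne' h4
  exact Subtype.ext h5.symm

/-- The logarithm `PSL₂(ℝ) → 𝔰𝔩₂(ℝ)`: for `g` in the neighbourhood `expPSL '' logTarget` of the
identity it is the unique `X ∈ logTarget` with `expPSL X = g`. Elsewhere it has a fixed junk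
value. -/
noncomputable def logPSL (g : PSL(2, ℝ)) : sl2 := Function.invFunOn expPSL logTarget g

/-! ### Euclidean structure, variance and entropy

A basis `b` of the Lie algebra identifies it with `ℝ³`. The Euclidean structure is the one for which
`b` is orthonormal. -/

/-- Coordinates with respect to the basis `b`, as a vector of Euclidean space `ℝ³`. -/
noncomputable def coord (b : Module.Basis (Fin 3) ℝ sl2) (X : sl2) : EuclideanSpace ℝ (Fin 3) :=
  WithLp.toLp 2 (b.equivFun X)

/-- `Var_{g₀}` of a probability measure `μ` on `PSL₂(ℝ)`: the covariance matrix of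
`log (g₀⁻¹ x)`, where `x` has law `μ`. -/
noncomputable def varAt (b : Module.Basis (Fin 3) ℝ sl2) (g₀ : PSL(2, ℝ))
    (μ : Measure PSL(2, ℝ)) : Matrix (Fin 3) (Fin 3) ℝ :=
  Matrix.of fun i j =>
    cov[fun x => coord b (logPSL (g₀⁻¹ * x)) i, fun x => coord b (logPSL (g₀⁻¹ * x)) j; μ]

/-- The conditional variance `Tr Var_{g₀}[x | h]`, for a random variable `g₀` that is a function of
`h` on the probability space: at `ω` it is the trace of `Var_{g₀(ω)}` of the regular conditional
distribution of `x` given `h`. -/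
noncomputable def trCondVar (b : Module.Basis (Fin 3) ℝ sl2) {Ω : Type*} [MeasurableSpace Ω]
    (P : Measure Ω) [IsFiniteMeasure P] (g₀ x h : Ω → PSL(2, ℝ)) (ω : Ω) : ℝ :=
  (varAt b (g₀ ω) (condDistrib x h P (h ω))).trace

/-- The image under `exp` of the ball of radius `r` about `0`. -/
noncomputable def expBall (b : Module.Basis (Fin 3) ℝ sl2) (r : ℝ) : Set PSL(2, ℝ) :=
  expPSL '' {X | ‖coord b X‖ < r}

/-- The Haar measure `m̃` on `PSL₂(ℝ)`, normalised so that its density at the identity with respect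
to `m ∘ log` is `1`, where `m` is Lebesgue measure in the coordinates given by `b`. Both measures
have continuous positive densities near the identity, so the density at the identity is
the limit of `m̃ (exp B_r) / m (B_r)` as `r → 0`. -/
noncomputable def haarPSL (b : Module.Basis (Fin 3) ℝ sl2) : Measure PSL(2, ℝ) :=
  limUnder (𝓝[>] (0 : ℝ)) (fun r : ℝ =>
    (volume (Metric.ball (0 : EuclideanSpace ℝ (Fin 3)) r) / Measure.haar (expBall b r) : ℝ≥0∞))
    • (Measure.haar : Measure PSL(2, ℝ))

/-- The entropy `H(μ) = - KL(μ, m̃) = - ∫ log (dμ/dm̃) dμ` of an absolutely continuous probability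
measure. -/
noncomputable def entropy (b : Module.Basis (Fin 3) ℝ sl2) (μ : Measure PSL(2, ℝ)) : ℝ :=
  - ∫ x, Real.log (μ.rnDeriv (haarPSL b) x).toReal ∂μ

/-- An absolutely continuous measure with density `f` has finite entropy if
`∫ f |log f| dm̃ < ∞`. -/
def HasFiniteEntropy (b : Module.Basis (Fin 3) ℝ sl2) (μ : Measure PSL(2, ℝ)) : Prop :=
  Integrable (fun x => (μ.rnDeriv (haarPSL b) x).toReal
    * |Real.log (μ.rnDeriv (haarPSL b) x).toReal|) (haarPSL b)

/-! ### Left invariant Riemannian distance -/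

/-- A `C¹` path `γ : [0,1] → SL₂(ℝ)` from `x` to `y` (as elements of `PSL₂(ℝ)`), together with its
left logarithmic derivative `velocity = γ⁻¹ γ'`. Every `C¹` path in `PSL₂(ℝ)` lifts to such a
path. -/
structure C1Path (x y : PSL(2, ℝ)) where
  path : ℝ → SL(2, ℝ)
  velocity : ℝ → sl2
  source : QuotientGroup.mk (path 0) = x
  target : QuotientGroup.mk (path 1) = y
  continuousOn_velocity : ContinuousOn velocity (Set.Icc 0 1)
  hasDeriv : ∀ t ∈ Set.Icc (0 : ℝ) 1,
    HasDerivWithinAt (fun u => (path u : Matrix (Fin 2) (Fin 2) ℝ))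
      ((path t : Matrix (Fin 2) (Fin 2) ℝ) * (velocity t : Matrix (Fin 2) (Fin 2) ℝ))
      (Set.Icc 0 1) t

/-- Length of a path for the left invariant Riemannian metric for which the basis `e` of the Lie
algebra is orthonormal at the identity. -/
noncomputable def C1Path.length (e : Module.Basis (Fin 3) ℝ sl2) {x y : PSL(2, ℝ)}
    (γ : C1Path x y) : ℝ≥0∞ :=
  ∫⁻ t in Set.Icc (0 : ℝ) 1, ‖coord e (γ.velocity t)‖ₑ

/-- The distance of that metric: the infimum of the lengths of `C¹` paths. -/
noncomputable def riemannDist (e : Module.Basis (Fin 3) ℝ sl2) (x y : PSL(2, ℝ)) : ℝ≥0∞ :=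
  ⨅ γ : C1Path x y, γ.length e

end PSLVariance

namespace PSLVariance

/-! ### Quantitative linearization -/

/-! Put `y₁ = g s₁`, `y₂ = g s₂`, let `V` be the trace of the variance of `s₁` and `I` the expected
conditional variance to be bounded below. Heuristically, `H(y₁, y₂) ≥ H(y₁) + H(y₂ | y₁, g) = H(y₁)
+ H(s₂)`, since Haar measure is left invariant and `s₂` is independent of `(g, s₁)`. Hence `H(y₁ |
y₂) ≥ H(y₁) + H(s₂) - H(y₂) = k + H(s₁)`. On the other hand `H(y₁ | y₂)` is at most the cross
entropy `-E log q(y₂, y₁)` for every conditional density `q`. `integral_log_density_le` merges both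
facts into one use of `log Z ≤ Z - 1`. No joint density is needed, and `q` may have mass up to `c₀`,
at the price of an error `c₀ - 1`.

The test density is Gaussian in `log (y₂⁻¹ y₁) = log (s₂⁻¹ s₁)`, centred at the conditional mean of
`log (y₂⁻¹ g)` given `y₂` plus the mean of `log s₁`. To first order `log (s₂⁻¹ s₁) = log s₂⁻¹ + log
s₁`, and `s₂⁻¹ = y₂⁻¹ g`. As `s₁` is independent of `(g, s₂)`, the second moment about this centre
is at most `I + V + O(ε³)` (`integral_norm_sq_le_of_near_sum`). Taking variance `V / 3` in each
coordinate bounds the cross entropy by `c + H(s₁) + 3 I / (2 V) + O(ε)`, where `V ≥ A ε²` absorbs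
the cubic error. Comparison with `k + H(s₁)` is the theorem.

Two geometric facts enter: `exists_logChart_bounds` (small elements have small logarithms, which add
up to a quadratic error) and `exists_lintegral_haarPSL_le` (normalised Haar measure is at most `1 +
O(r)` times Lebesgue measure in logarithmic coordinates, so the Gaussian has mass at most `1 +
O(ε)`). The latter rests on the explicit Haar measure `shearHaar`. -/

/-- The derivative of a `C²` map is locally Lipschitz, so on the ball of radius `r` it differs from
`f'` by `O(r)`, and the mean value inequality applies to `f - f'`. With `y = 0` this is a quadratic
Taylor bound; for general `x`, `y` it yields local injectivity and surjectivity. -/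
theorem exists_norm_sub_sub_le_of_contDiffAt {E F : Type*} [NormedAddCommGroup E] [NormedSpace ℝ E]
    [NormedAddCommGroup F] [NormedSpace ℝ F] {f : E → F} {f' : E →L[ℝ] F}
    (hf : ContDiffAt ℝ 2 f 0) (hf' : HasFDerivAt f f' 0) :
    ∃ C : ℝ, 0 < C ∧ ∃ r₀ : ℝ, 0 < r₀ ∧
      (∀ x, ‖x‖ ≤ r₀ → DifferentiableAt ℝ f x ∧ ‖fderiv ℝ f x - f'‖ ≤ C * ‖x‖) ∧
      ∀ r, r ≤ r₀ → ∀ x y, ‖x‖ ≤ r → ‖y‖ ≤ r → ‖f x - f y - f' (x - y)‖ ≤ C * r * ‖x - y‖ := by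
  have h1 : ContDiffAt ℝ 1 (fderiv ℝ f) 0 := hf.fderiv_right (by norm_num)
  obtain ⟨K, t, ht, hK⟩ := h1.exists_lipschitzOnWith
  have h2 : ∀ᶠ x in 𝓝 (0 : E), DifferentiableAt ℝ f x :=
    (hf.eventually (by simp)).mono fun x hx => hx.differentiableAt (by norm_num)
  obtain ⟨r, hr, hrt⟩ := Metric.nhds_basis_closedBall.mem_iff.1 (inter_mem ht h2)
  have h3 : ∀ x, ‖x‖ ≤ r → DifferentiableAt ℝ f x ∧ ‖fderiv ℝ f x - f'‖ ≤ (K + 1) * ‖x‖ := by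
    intro x hx
    have hx' := hrt (mem_closedBall_zero_iff.2 hx)
    refine ⟨hx'.2, ?_⟩
    have h0 := (hrt (Metric.mem_closedBall_self hr.le)).1
    have h4 := hK.norm_sub_le hx'.1 h0
    rw [hf'.fderiv, sub_zero] at h4
    nlinarith [norm_nonneg x]
  refine ⟨K + 1, by positivity, r, hr, h3, fun s hs x y hx hy => ?_⟩
  have h5 := (convex_closedBall (0 : E) s).norm_image_sub_le_of_norm_hasFDerivWithin_le'
    (f := f) (f' := fderiv ℝ f) (φ := f') (C := (K + 1) * s) (x := y) (y := x)
    (fun z hz => ((h3 z ((mem_closedBall_zero_iff.1 hz).trans hs)).1.hasFDerivAt).hasFDerivWithinAt)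
    (fun z hz => (h3 z ((mem_closedBall_zero_iff.1 hz).trans hs)).2.trans ?_)
    (mem_closedBall_zero_iff.2 hy) (mem_closedBall_zero_iff.2 hx)
  · exact h5
  · have := mem_closedBall_zero_iff.1 hz
    gcongr

/-! ### Exponential coordinates -/

/-- Euclidean space `ℝ³`. -/
abbrev E3 : Type := EuclideanSpace ℝ (Fin 3)

/-- The element of the Lie algebra with coordinates `x` in the basis `b`. -/
noncomputable def toSl (b : Module.Basis (Fin 3) ℝ sl2) : E3 ≃ₗ[ℝ] sl2 :=
  (WithLp.linearEquiv 2 ℝ (Fin 3 → ℝ)).trans b.equivFun.symm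

/-- The matrix with coordinates `x` in the basis `b`, as a linear map. -/
noncomputable def toMatLin (b : Module.Basis (Fin 3) ℝ sl2) :
    E3 →ₗ[ℝ] Matrix (Fin 2) (Fin 2) ℝ where
  toFun x := (toSl b x : Matrix (Fin 2) (Fin 2) ℝ)
  map_add' x y := by rw [map_add]; rfl
  map_smul' c x := by rw [map_smul]; rfl

theorem coord_toSl (b : Module.Basis (Fin 3) ℝ sl2) (x : E3) : coord b (toSl b x) = x := by
  simp only [coord, toSl, LinearEquiv.trans_apply, LinearEquiv.apply_symm_apply]
  rfl

theorem toSl_coord (b : Module.Basis (Fin 3) ℝ sl2) (X : sl2) : toSl b (coord b X) = X := by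
  simp [coord, toSl]

/-- The exponential map to `SL(2, ℝ)` in the coordinates given by `b`. -/
noncomputable def expSL (b : Module.Basis (Fin 3) ℝ sl2) (x : E3) : SL(2, ℝ) :=
  ⟨NormedSpace.exp (toSl b x : Matrix (Fin 2) (Fin 2) ℝ), det_exp_sl2 _⟩

/-- The exponential map to `PSL(2, ℝ)` in the coordinates given by `b`. -/
noncomputable def expChart (b : Module.Basis (Fin 3) ℝ sl2) (x : E3) : PSL(2, ℝ) :=
  expPSL (toSl b x)

theorem expChart_eq_mk (b : Module.Basis (Fin 3) ℝ sl2) (x : E3) :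
    expChart b x = QuotientGroup.mk (expSL b x) := rfl

/-- The logarithm on `PSL(2, ℝ)` in the coordinates given by `b`. -/
noncomputable def logChart (b : Module.Basis (Fin 3) ℝ sl2) (g : PSL(2, ℝ)) : E3 :=
  coord b (logPSL g)

theorem expBall_eq (b : Module.Basis (Fin 3) ℝ sl2) (r : ℝ) :
    expBall b r = expChart b '' Metric.ball 0 r := by
  ext g
  constructor
  · rintro ⟨X, hX, rfl⟩
    exact ⟨coord b X, by simpa using hX, by rw [expChart, toSl_coord]⟩
  · rintro ⟨x, hx, rfl⟩
    exact ⟨toSl b x, by simpa [coord_toSl] using hx, rfl⟩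

/-! ### Matrix coordinates near the identity and the derivative of exp -/

section Chart

open scoped Matrix.Norms.Operator

/-- The matrix with coordinates `x` in the basis `b`. -/
noncomputable def toMat (b : Module.Basis (Fin 3) ℝ sl2) :
    E3 →L[ℝ] Matrix (Fin 2) (Fin 2) ℝ :=
  LinearMap.toContinuousLinearMap (toMatLin b)

theorem toMat_apply (b : Module.Basis (Fin 3) ℝ sl2) (x : E3) :
    toMat b x = (toSl b x : Matrix (Fin 2) (Fin 2) ℝ) := rfl

theorem toMat_injective (b : Module.Basis (Fin 3) ℝ sl2) : Function.Injective (toMat b) :=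
  fun _ _ h => (toSl b).injective (Subtype.ext h)

theorem coe_expSL (b : Module.Basis (Fin 3) ℝ sl2) (x : E3) :
    (expSL b x : Matrix (Fin 2) (Fin 2) ℝ) = NormedSpace.exp (toMat b x) := rfl

theorem contDiff_expMat : ContDiff ℝ 2
    (NormedSpace.exp : Matrix (Fin 2) (Fin 2) ℝ → Matrix (Fin 2) (Fin 2) ℝ) :=
  contDiff_iff_contDiffAt.2 fun x =>
    (NormedSpace.exp_analytic (𝕂 := ℝ) x).contDiffAt

theorem contDiff_expSL (b : Module.Basis (Fin 3) ℝ sl2) :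
    ContDiff ℝ 2 fun x => (expSL b x : Matrix (Fin 2) (Fin 2) ℝ) :=
  contDiff_expMat.comp (toMat b).contDiff

theorem hasFDerivAt_expSL (b : Module.Basis (Fin 3) ℝ sl2) :
    HasFDerivAt (fun x => (expSL b x : Matrix (Fin 2) (Fin 2) ℝ)) (toMat b) 0 := by
  have h : HasFDerivAt (NormedSpace.exp : Matrix (Fin 2) (Fin 2) ℝ → Matrix (Fin 2) (Fin 2) ℝ)
      (1 : Matrix (Fin 2) (Fin 2) ℝ →L[ℝ] Matrix (Fin 2) (Fin 2) ℝ) (toMat b 0) := by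
    rw [map_zero]
    exact hasFDerivAt_exp_zero
  exact h.comp (0 : E3) (toMat b).hasFDerivAt

theorem expSL_zero (b : Module.Basis (Fin 3) ℝ sl2) : expSL b 0 = 1 := by
  ext i j
  rw [coe_expSL]
  simp

theorem continuous_expSL (b : Module.Basis (Fin 3) ℝ sl2) : Continuous (expSL b) :=
  Continuous.subtype_mk (contDiff_expSL b).continuous _

theorem continuous_expChart (b : Module.Basis (Fin 3) ℝ sl2) : Continuous (expChart b) :=
  continuous_quot_mk.comp (continuous_expSL b)

/-- The coordinates of a matrix of determinant one: the first column, and the entry of the first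
row that determines the second column. -/
noncomputable def colShear (M : Matrix (Fin 2) (Fin 2) ℝ) : (Fin 2 → ℝ) × ℝ :=
  (fun i => M i 0, M 0 1 / M 0 0)

/-- The determinant equation recovers the lower right entry once the upper left one is nonzero. -/
theorem eq_of_colShear_eq {g h : SL(2, ℝ)} (hg : g 0 0 ≠ 0)
    (hgh : colShear (g : Matrix (Fin 2) (Fin 2) ℝ) = colShear (h : Matrix (Fin 2) (Fin 2) ℝ)) :
    g = h := by
  have h1 := congrArg Prod.fst hgh
  have h2 : g 0 1 / g 0 0 = h 0 1 / h 0 0 := congrArg Prod.snd hgh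
  have h3 : g 0 0 = h 0 0 := congrFun h1 0
  have h4 : g 1 0 = h 1 0 := congrFun h1 1
  have h5 : g 0 1 = h 0 1 := by
    rw [h3] at h2 hg
    field_simp at h2
    exact h2
  have d1 := g.det_coe
  have d2 := h.det_coe
  rw [Matrix.det_fin_two] at d1 d2
  have h6 : g 1 1 = h 1 1 := by
    apply mul_left_cancel₀ hg
    rw [← h3, ← h4, ← h5] at d2
    linarith
  ext i j
  fin_cases i <;> fin_cases j <;> assumption

/-- The derivative of `colShear` at the identity. -/
noncomputable def colShearDeriv : Matrix (Fin 2) (Fin 2) ℝ →L[ℝ] (Fin 2 → ℝ) × ℝ :=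
  (ContinuousLinearMap.pi fun i => LinearMap.toContinuousLinearMap
      (Matrix.entryLinearMap ℝ ℝ i (0 : Fin 2))).prod
    (LinearMap.toContinuousLinearMap (Matrix.entryLinearMap ℝ ℝ (0 : Fin 2) (1 : Fin 2)))

theorem contDiffAt_colShear {M : Matrix (Fin 2) (Fin 2) ℝ} (hM : M 0 0 ≠ 0) :
    ContDiffAt ℝ 2 colShear M := by
  have h : ∀ i j : Fin 2, ContDiff ℝ 2 fun M : Matrix (Fin 2) (Fin 2) ℝ => M i j := fun i j =>
    (LinearMap.toContinuousLinearMap (Matrix.entryLinearMap ℝ ℝ i j)).contDiff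
  exact (contDiffAt_pi.2 fun i => (h i 0).contDiffAt).prodMk
    ((h 0 1).contDiffAt.div (h 0 0).contDiffAt hM)

theorem hasFDerivAt_colShear : HasFDerivAt colShear colShearDeriv 1 := by
  have h : ∀ i j : Fin 2, HasFDerivAt (fun M : Matrix (Fin 2) (Fin 2) ℝ => M i j)
      (LinearMap.toContinuousLinearMap (Matrix.entryLinearMap ℝ ℝ i j)) 1 := fun i j =>
    (LinearMap.toContinuousLinearMap (Matrix.entryLinearMap ℝ ℝ i j)).hasFDerivAt
  have h2 : HasFDerivAt (fun M : Matrix (Fin 2) (Fin 2) ℝ => M 0 1 / M 0 0)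
      (LinearMap.toContinuousLinearMap (Matrix.entryLinearMap ℝ ℝ (0 : Fin 2) (1 : Fin 2))) 1 := by
    simp only [div_eq_mul_inv]
    have h3 : HasDerivAt (fun y : ℝ => y⁻¹) (-1) ((1 : Matrix (Fin 2) (Fin 2) ℝ) 0 0) := by
      simpa using hasDerivAt_inv (one_ne_zero (α := ℝ))
    have h4 : HasFDerivAt (fun M : Matrix (Fin 2) (Fin 2) ℝ => (M 0 0)⁻¹) _ 1 :=
      h3.comp_hasFDerivAt 1 (h 0 0)
    -- The contribution of the derivative of `1 / M 0 0` disappears because it is multiplied by the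
    -- off-diagonal entry `M 0 1`, which is `0` at the identity.
    refine ((h 0 1).mul h4).congr_fderiv ?_
    ext M
    simp only [Matrix.one_apply_eq, inv_one]
    simp only [ne_eq, zero_ne_one, not_false_eq_true, Matrix.one_apply_ne, zero_smul, zero_add]
    exact one_mul _
  exact (hasFDerivAt_pi.2 fun i => h i 0).prodMk h2

/-- The linear part at `0` of `colShear ∘ exp`. -/
noncomputable def chartLin (b : Module.Basis (Fin 3) ℝ sl2) : E3 ≃L[ℝ] (Fin 2 → ℝ) × ℝ :=
  (LinearMap.linearEquivOfInjective (colShearDeriv ∘L toMat b).toLinearMap (by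
    rw [injective_iff_map_eq_zero]
    intro x hx
    have h1 : ∀ i, toMat b x i 0 = 0 := fun i => congrFun (congrArg Prod.fst hx) i
    have h2 : toMat b x 0 1 = 0 := congrArg Prod.snd hx
    -- `colShear` does not see the lower right entry; trace zero forces it to vanish as well.
    have h3 := sl2_trace (toSl b x)
    rw [← toMat_apply, Matrix.trace_fin_two, h1 0, zero_add] at h3
    apply toMat_injective b
    ext i j
    fin_cases i <;> fin_cases j <;> simp [h1, h2, h3])
    (by simp)).toContinuousLinearEquiv

theorem chartLin_apply (b : Module.Basis (Fin 3) ℝ sl2) (x : E3) :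
    chartLin b x = colShearDeriv (toMat b x) := rfl

/-- The exponential map in the coordinates `colShear`, normalised to have derivative the identity
at `0`. -/
noncomputable def chartMap (b : Module.Basis (Fin 3) ℝ sl2) (x : E3) : E3 :=
  (chartLin b).symm (colShear (expSL b x : Matrix (Fin 2) (Fin 2) ℝ))

theorem contDiffAt_chartMap (b : Module.Basis (Fin 3) ℝ sl2) : ContDiffAt ℝ 2 (chartMap b) 0 := by
  have h : ContDiffAt ℝ 2 (colShear ∘ fun x => (expSL b x : Matrix (Fin 2) (Fin 2) ℝ)) 0 :=
    (contDiffAt_colShear (by simp [expSL_zero])).comp _ (contDiff_expSL b).contDiffAt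
  exact (chartLin b).symm.contDiff.contDiffAt.comp _ h

theorem hasFDerivAt_chartMap (b : Module.Basis (Fin 3) ℝ sl2) :
    HasFDerivAt (chartMap b) (ContinuousLinearMap.id ℝ E3) 0 := by
  have h : HasFDerivAt colShear colShearDeriv (expSL b 0 : Matrix (Fin 2) (Fin 2) ℝ) := by
    rw [expSL_zero]
    exact hasFDerivAt_colShear
  have h1 := (chartLin b).symm.hasFDerivAt.comp (0 : E3) (h.comp (0 : E3) (hasFDerivAt_expSL b))
  refine h1.congr_fderiv ?_
  ext1 x
  change (chartLin b).symm (colShearDeriv (toMat b x)) = x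
  rw [← chartLin_apply, ContinuousLinearEquiv.symm_apply_apply]

end Chart

/-! ### Local inversion of exp, approximate additivity, measurability of log -/

section ExpLog

theorem exists_norm_linearMap_le {E F : Type*} [NormedAddCommGroup E] [NormedSpace ℝ E]
    [FiniteDimensional ℝ E] [NormedAddCommGroup F] [NormedSpace ℝ F] (f : E →ₗ[ℝ] F) :
    ∃ C : ℝ, 0 < C ∧ ∀ x, ‖f x‖ ≤ C * ‖x‖ :=
  (LinearMap.toContinuousLinearMap f).bound

open scoped Matrix.Norms.Operator

/-- Quantitative local surjectivity of the exponential. Near `0` the map `chartMap` is a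
perturbation of the identity with Lipschitz error `1/2`, so it covers a ball of half the radius. A
matrix near `1` has `colShear` coordinates in that ball, and these coordinates determine it. -/
theorem exists_expSL_eq (b : Module.Basis (Fin 3) ℝ sl2) :
    ∃ K : ℝ, 0 < K ∧ ∃ δ₀ : ℝ, 0 < δ₀ ∧ ∀ δ, δ ≤ δ₀ → ∀ h : SL(2, ℝ),
      ‖(h : Matrix (Fin 2) (Fin 2) ℝ) - 1‖ ≤ δ → ∃ x, ‖x‖ ≤ K * δ ∧ expSL b x = h := by
  obtain ⟨C, hC, r₀, hr₀, -, hlin⟩ :=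
    exists_norm_sub_sub_le_of_contDiffAt (contDiffAt_chartMap b) (hasFDerivAt_chartMap b)
  have hcs : ContDiffAt ℝ 1 (fun M => (chartLin b).symm (colShear M)) 1 :=
    (chartLin b).symm.contDiff.contDiffAt.comp _
      ((contDiffAt_colShear (by simp)).of_le (by norm_num))
  obtain ⟨L, t, ht, hL⟩ := hcs.exists_lipschitzOnWith
  have hne : ∀ᶠ M : Matrix (Fin 2) (Fin 2) ℝ in 𝓝 1, M 0 0 ≠ 0 := by
    have hc : Continuous fun M : Matrix (Fin 2) (Fin 2) ℝ => M 0 0 :=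
      (LinearMap.toContinuousLinearMap (Matrix.entryLinearMap ℝ ℝ (0 : Fin 2) (0 : Fin 2))).cont
    exact hc.continuousAt.eventually_ne (by simp)
  obtain ⟨δ₁, hδ₁, hδ₁t⟩ := Metric.nhds_basis_closedBall.mem_iff.1 (inter_mem ht hne)
  set r₁ := min r₀ (1 / (2 * C)) with hr₁
  have hr₁0 : 0 < r₁ := lt_min hr₀ (by positivity)
  have hCr₁ : C * r₁ ≤ 1 / 2 := by
    calc C * r₁ ≤ C * (1 / (2 * C)) := by gcongr; exact min_le_right _ _
      _ = 1 / 2 := by field_simp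
  have happrox : ApproximatesLinearOn (chartMap b) (ContinuousLinearMap.id ℝ E3)
      (Metric.closedBall 0 r₁) (1 / 2) := by
    intro x hx y hy
    have h := hlin r₁ (min_le_left _ _) x y (mem_closedBall_zero_iff.1 hx)
      (mem_closedBall_zero_iff.1 hy)
    refine h.trans ?_
    simp only [NNReal.coe_div, NNReal.coe_one, NNReal.coe_ofNat]
    gcongr
  let inv : (ContinuousLinearMap.id ℝ E3).NonlinearRightInverse :=
    ⟨id, 1, fun y => by simp, fun y => rfl⟩
  -- The factor `2` pays for the halved radius, `L` for the Lipschitz constant of the coordinates;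
  -- `L + 1` keeps the constant positive if `L = 0`.
  refine ⟨2 * (L + 1), by positivity, min δ₁ (r₁ / (2 * (L + 1))), by positivity,
    fun δ hδ h hh => ?_⟩
  have hδ0 : 0 ≤ δ := (norm_nonneg _).trans hh
  have hε : 2 * (L + 1) * δ ≤ r₁ := by
    have := hδ.trans (min_le_right _ _)
    rw [le_div_iff₀ (by positivity)] at this
    linarith
  have hsurj := happrox.surjOn_closedBall_of_nonlinearRightInverse inv
    (ε := 2 * (L + 1) * δ) (b := 0) (by positivity) (Metric.closedBall_subset_closedBall hε)
  have hmem : (h : Matrix (Fin 2) (Fin 2) ℝ) ∈ Metric.closedBall 1 δ₁ :=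
    mem_closedBall_iff_norm.2 (hh.trans (hδ.trans (min_le_left _ _)))
  have h0 : chartMap b 0 = (chartLin b).symm (colShear 1) := by
    simp [chartMap, expSL_zero]
  have htarget : (chartLin b).symm (colShear (h : Matrix (Fin 2) (Fin 2) ℝ)) ∈
      Metric.closedBall (chartMap b 0) ((((inv.nnnorm : ℝ)⁻¹ - ((1 / 2 : NNReal) : ℝ))) *
        (2 * (L + 1) * δ)) := by
    rw [mem_closedBall_iff_norm, h0]
    refine (hL.norm_sub_le (hδ₁t hmem).1 (hδ₁t (Metric.mem_closedBall_self hδ₁.le)).1).trans ?_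
    simp only [inv, NNReal.coe_div, NNReal.coe_one, NNReal.coe_ofNat]
    have : (L : ℝ) * ‖(h : Matrix (Fin 2) (Fin 2) ℝ) - 1‖ ≤ L * δ := by gcongr
    linarith
  obtain ⟨x, hx, hxh⟩ := hsurj htarget
  refine ⟨x, mem_closedBall_zero_iff.1 hx, ?_⟩
  exact (eq_of_colShear_eq (hδ₁t hmem).2 ((chartLin b).symm.injective hxh).symm).symm

/-- First order Baker-Campbell-Hausdorff. Both `exp x * exp y - 1` and `exp z - 1` agree with their
linear parts up to second order, and the two matrices are equal, so the linear parts `x + y` and `z`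
differ by `O(r²)`. The linear map `toMat b` is injective, hence bounded below, which carries the
estimate back to `E3`. -/
theorem exists_expSL_mul (b : Module.Basis (Fin 3) ℝ sl2) :
    ∃ K : ℝ, 0 < K ∧ ∃ r₀ : ℝ, 0 < r₀ ∧ ∀ r, 0 ≤ r → r ≤ r₀ → ∀ x y : E3, ‖x‖ ≤ r → ‖y‖ ≤ r →
      ∃ z, expSL b x * expSL b y = expSL b z ∧ ‖z‖ ≤ K * r ∧ ‖z - (x + y)‖ ≤ K * r ^ 2 := by
  obtain ⟨K, hK, δ₀, hδ₀, hsurj⟩ := exists_expSL_eq b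
  obtain ⟨C, hC, r₁, hr₁, -, hlin⟩ := exists_norm_sub_sub_le_of_contDiffAt
    (contDiff_expSL b).contDiffAt (hasFDerivAt_expSL b)
  have hF : ContDiff ℝ 2 fun p : E3 × E3 =>
      (expSL b p.1 : Matrix (Fin 2) (Fin 2) ℝ) * (expSL b p.2 : Matrix (Fin 2) (Fin 2) ℝ) :=
    ((contDiff_expSL b).comp contDiff_fst).mul ((contDiff_expSL b).comp contDiff_snd)
  have hF' : HasFDerivAt (fun p : E3 × E3 =>
      (expSL b p.1 : Matrix (Fin 2) (Fin 2) ℝ) * (expSL b p.2 : Matrix (Fin 2) (Fin 2) ℝ))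
      (toMat b ∘L ContinuousLinearMap.fst ℝ E3 E3 + toMat b ∘L ContinuousLinearMap.snd ℝ E3 E3)
      0 := by
    have h1 : HasFDerivAt (fun p : E3 × E3 => (expSL b p.1 : Matrix (Fin 2) (Fin 2) ℝ))
        (toMat b ∘L ContinuousLinearMap.fst ℝ E3 E3) 0 :=
      HasFDerivAt.comp (g := fun x => (expSL b x : Matrix (Fin 2) (Fin 2) ℝ)) (0 : E3 × E3)
        (hasFDerivAt_expSL b) hasFDerivAt_fst
    have h2 : HasFDerivAt (fun p : E3 × E3 => (expSL b p.2 : Matrix (Fin 2) (Fin 2) ℝ))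
        (toMat b ∘L ContinuousLinearMap.snd ℝ E3 E3) 0 :=
      HasFDerivAt.comp (g := fun x => (expSL b x : Matrix (Fin 2) (Fin 2) ℝ)) (0 : E3 × E3)
        (hasFDerivAt_expSL b) hasFDerivAt_snd
    refine (h1.mul' h2).congr_fderiv ?_
    apply ContinuousLinearMap.ext
    intro p
    change ((expSL b 0 : SL(2, ℝ)) : Matrix (Fin 2) (Fin 2) ℝ) * toMat b p.2
      + toMat b p.1 * ((expSL b 0 : SL(2, ℝ)) : Matrix (Fin 2) (Fin 2) ℝ)
        = toMat b p.1 + toMat b p.2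
    rw [expSL_zero, Matrix.SpecialLinearGroup.coe_one, one_mul, mul_one, add_comm]
  obtain ⟨C', hC', r₂, hr₂, -, hlin'⟩ := exists_norm_sub_sub_le_of_contDiffAt hF.contDiffAt hF'
  obtain ⟨κ, hκ, hanti⟩ := (toMatLin b).exists_antilipschitzWith
    (LinearMap.ker_eq_bot.2 (toMat_injective b))
  obtain ⟨N, hN, hNb⟩ := exists_norm_linearMap_le (toMatLin b)
  replace hNb : ∀ x, ‖toMat b x‖ ≤ N * ‖x‖ := hNb
  -- `D * r` dominates `‖exp x * exp y - 1‖`: the quadratic remainder is at most `C' * r₂ * r` and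
  -- the linear part at most `2 * N * r`.
  set D := C' * r₂ + 2 * N + 1 with hD
  have hD0 : 0 < D := by positivity
  refine ⟨K * D + κ * (C' + C * (K * D) ^ 2), by positivity,
    min r₂ (min (δ₀ / D) (r₁ / (K * D))), by positivity, fun r hr0 hr x y hx hy => ?_⟩
  have hr2 : r ≤ r₂ := hr.trans (min_le_left _ _)
  have hrδ : D * r ≤ δ₀ := by
    have := hr.trans ((min_le_right _ _).trans (min_le_left _ _))
    rw [le_div_iff₀ hD0] at this
    linarith
  have hrr₁ : K * D * r ≤ r₁ := by
    have := hr.trans ((min_le_right _ _).trans (min_le_right _ _))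
    rw [le_div_iff₀ (by positivity)] at this
    linarith
  have hp : ‖((x, y) : E3 × E3)‖ ≤ r := by simp [Prod.norm_def, hx, hy]
  have h1 : ‖((expSL b x * expSL b y : SL(2, ℝ)) : Matrix (Fin 2) (Fin 2) ℝ) - 1
      - toMat b (x + y)‖ ≤ C' * r ^ 2 := by
    have := hlin' r hr2 (x, y) 0 hp (by simpa using hr0)
    simp only [Prod.fst_zero, Prod.snd_zero, expSL_zero, sub_zero,
      Matrix.SpecialLinearGroup.coe_one, mul_one] at this
    rw [Matrix.SpecialLinearGroup.coe_mul, map_add]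
    refine this.trans ?_
    rw [sq, mul_assoc]
    gcongr
  have hxy : ‖toMat b (x + y)‖ ≤ 2 * N * r := by
    refine (hNb _).trans ?_
    have := (norm_add_le x y).trans (add_le_add hx hy)
    nlinarith
  have h2 : ‖((expSL b x * expSL b y : SL(2, ℝ)) : Matrix (Fin 2) (Fin 2) ℝ) - 1‖ ≤ D * r := by
    have h3 := norm_add_le
      (((expSL b x * expSL b y : SL(2, ℝ)) : Matrix (Fin 2) (Fin 2) ℝ) - 1 - toMat b (x + y))
      (toMat b (x + y))
    rw [sub_add_cancel] at h3
    have h4 : C' * r ^ 2 ≤ C' * r₂ * r := by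
      rw [sq, ← mul_assoc]
      gcongr
    rw [hD]
    linarith
  obtain ⟨z, hz, hzxy⟩ := hsurj (D * r) hrδ _ h2
  rw [← mul_assoc] at hz
  have h5 : ‖((expSL b z : SL(2, ℝ)) : Matrix (Fin 2) (Fin 2) ℝ) - 1 - toMat b z‖
      ≤ C * (K * D) ^ 2 * r ^ 2 := by
    have := hlin (K * D * r) hrr₁ z 0 hz (by simp; positivity)
    simp only [expSL_zero, sub_zero, Matrix.SpecialLinearGroup.coe_one] at this
    refine this.trans ?_
    calc C * (K * D * r) * ‖z‖ ≤ C * (K * D * r) * (K * D * r) := by gcongr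
      _ = C * (K * D) ^ 2 * r ^ 2 := by ring
  have h6 : ‖z - (x + y)‖ ≤ κ * ‖toMat b (z - (x + y))‖ := by
    have := hanti.le_mul_dist (z - (x + y)) 0
    rw [dist_zero_right, map_zero, dist_zero_right] at this
    exact this
  have h7 : ‖toMat b (z - (x + y))‖ ≤ C' * r ^ 2 + C * (K * D) ^ 2 * r ^ 2 := by
    rw [hzxy] at h5
    have : toMat b (z - (x + y))
        = (((expSL b x * expSL b y : SL(2, ℝ)) : Matrix (Fin 2) (Fin 2) ℝ) - 1
            - toMat b (x + y))
          - (((expSL b x * expSL b y : SL(2, ℝ)) : Matrix (Fin 2) (Fin 2) ℝ) - 1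
            - toMat b z) := by
      rw [map_sub]
      abel
    rw [this]
    exact (norm_sub_le _ _).trans (add_le_add h1 h5)
  refine ⟨z, hzxy.symm, hz.trans ?_, h6.trans ?_⟩
  · rw [add_mul]
    have : 0 ≤ κ * (C' + C * (K * D) ^ 2) * r := by positivity
    linarith
  · have h8 : (κ : ℝ) * ‖toMat b (z - (x + y))‖ ≤ κ * (C' * r ^ 2 + C * (K * D) ^ 2 * r ^ 2) := by
      gcongr
    have : 0 ≤ K * D * r ^ 2 := by positivity
    linarith

theorem exists_logChart_expChart (b : Module.Basis (Fin 3) ℝ sl2) :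
    ∃ r₀ : ℝ, 0 < r₀ ∧ (∀ x, ‖x‖ ≤ r₀ → toSl b x ∈ logTarget) ∧
      ∀ x, ‖x‖ ≤ r₀ → logChart b (expChart b x) = x := by
  have hc : Continuous fun x => (toMat b x).det := (toMat b).continuous.matrix_det
  have h0 : ∀ᶠ x in 𝓝 (0 : E3), (toMat b x).det < (Real.pi / 2) ^ 2 :=
    hc.continuousAt.eventually_lt continuousAt_const (by simp; positivity)
  obtain ⟨r, hr, hrt⟩ := Metric.nhds_basis_closedBall.mem_iff.1 h0
  have h : ∀ x, ‖x‖ ≤ r → toSl b x ∈ logTarget := fun x hx => hrt (mem_closedBall_zero_iff.2 hx)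
  refine ⟨r, hr, h, fun x hx => ?_⟩
  rw [logChart, logPSL, expChart, expPSL_injOn.leftInvOn_invFunOn (h x hx), coord_toSl]

theorem measurableSet_logTarget (b : Module.Basis (Fin 3) ℝ sl2) :
    MeasurableSet {x : E3 | toSl b x ∈ logTarget} := by
  have hc : Continuous fun x => (toMat b x).det := (toMat b).continuous.matrix_det
  exact measurableSet_lt hc.measurable measurable_const

theorem expChart_injOn (b : Module.Basis (Fin 3) ℝ sl2) :
    Set.InjOn (expChart b) {x : E3 | toSl b x ∈ logTarget} :=
  fun _ hx _ hy hxy => (toSl b).injective (expPSL_injOn hx hy hxy)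

/-- By Lusin-Souslin, the continuous injective image of a Borel set is Borel, which handles the
image of `logTarget`. Off this image the junk value makes the map constant, so a preimage contains
the whole complement or none of it. -/
theorem measurable_logChart (b : Module.Basis (Fin 3) ℝ sl2) : Measurable (logChart b) := by
  set T := {x : E3 | toSl b x ∈ logTarget} with hT
  have himg : ∀ E ⊆ T, MeasurableSet E → MeasurableSet (expChart b '' E) := fun E hET hE =>
    hE.image_of_continuousOn_injOn (continuous_expChart b).continuousOn
      ((expChart_injOn b).mono hET)
  have hlog : ∀ x ∈ T, logChart b (expChart b x) = x := fun x hx => by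
    rw [logChart, logPSL, expChart, expPSL_injOn.leftInvOn_invFunOn hx, coord_toSl]
  have hjunk : ∀ g ∉ expChart b '' T, ∀ h ∉ expChart b '' T, logChart b g = logChart b h := by
    have hn : ∀ g ∉ expChart b '' T, ¬ ∃ X ∈ logTarget, expPSL X = g := by
      rintro g hg ⟨X, hX, rfl⟩
      refine hg ⟨coord b X, ?_, ?_⟩
      · rw [hT, Set.mem_ofPred_eq, toSl_coord]
        exact hX
      · rw [expChart, toSl_coord]
    intro g hg h hh
    rw [logChart, logChart, logPSL, logPSL, Function.invFunOn_neg (hn g hg),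
      Function.invFunOn_neg (hn h hh)]
  intro E hE
  have hsplit : logChart b ⁻¹' E
      = expChart b '' (E ∩ T) ∪ (logChart b ⁻¹' E ∩ (expChart b '' T)ᶜ) := by
    ext g
    by_cases hg : g ∈ expChart b '' T
    · simp only [Set.mem_union, Set.mem_inter_iff, Set.mem_compl_iff, hg, not_true, and_false,
        or_false]
      obtain ⟨x, hx, rfl⟩ := hg
      rw [Set.mem_preimage, hlog x hx]
      refine ⟨fun h => ⟨x, ⟨h, hx⟩, rfl⟩, ?_⟩
      rintro ⟨y, ⟨hy, hyT⟩, hxy⟩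
      rwa [← expChart_injOn b hyT hx hxy]
    · simp only [Set.mem_union, Set.mem_inter_iff, Set.mem_compl_iff, hg, not_false_eq_true,
        and_true]
      refine ⟨Or.inr, fun h => h.resolve_left fun h' => hg ?_⟩
      exact Set.image_mono Set.inter_subset_right h'
  rw [hsplit]
  refine (himg _ Set.inter_subset_right (hE.inter (measurableSet_logTarget b))).union ?_
  have hTm := (himg T subset_rfl (measurableSet_logTarget b)).compl
  by_cases hne : ∃ h, h ∉ expChart b '' T ∧ logChart b h ∈ E
  · obtain ⟨h, hh, hhE⟩ := hne
    convert hTm using 1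
    refine Set.inter_eq_right.2 fun g hg => ?_
    rw [Set.mem_preimage, hjunk g hg h hh]
    exact hhE
  · convert MeasurableSet.empty using 1
    refine Set.eq_empty_of_forall_notMem ?_
    rintro g ⟨hg, hg'⟩
    exact hne ⟨g, hg', hg⟩

end ExpLog

theorem expChart_neg (b : Module.Basis (Fin 3) ℝ sl2) (x : E3) :
    expChart b (-x) = (expChart b x)⁻¹ := by
  rw [expChart_eq_mk, expChart_eq_mk, ← QuotientGroup.mk_inv]
  congr 1
  rw [eq_inv_iff_mul_eq_one]
  apply Subtype.ext
  rw [Matrix.SpecialLinearGroup.coe_mul, coe_expSL, coe_expSL, map_neg,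
    ← Matrix.exp_add_of_commute _ _ (Commute.neg_left (Commute.refl (toMat b x))), neg_add_cancel,
    NormedSpace.exp_zero]
  rfl

/-! ### Riemannian distance against exponential coordinates -/

section Distance

open scoped Matrix.Norms.Operator

theorem continuousOn_coord_velocity (e : Module.Basis (Fin 3) ℝ sl2) {x y : PSL(2, ℝ)}
    (γ : C1Path x y) : ContinuousOn (fun t => coord e (γ.velocity t)) (Set.Icc 0 1) := by
  obtain ⟨inv, hinv⟩ := (toMatLin e).exists_leftInverse_of_injective
    (LinearMap.ker_eq_bot.2 (toMat_injective e))
  have h : ∀ X : sl2, coord e X = LinearMap.toContinuousLinearMap inv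
      (X : Matrix (Fin 2) (Fin 2) ℝ) := fun X => by
    have := LinearMap.congr_fun hinv (coord e X)
    have h2 : toMatLin e (coord e X) = (X : Matrix (Fin 2) (Fin 2) ℝ) :=
      congrArg Subtype.val (toSl_coord e X)
    rw [LinearMap.comp_apply, h2] at this
    exact this.symm
  simp only [h]
  exact (ContinuousLinearMap.continuous _).comp_continuousOn
    (continuous_subtype_val.comp_continuousOn γ.continuousOn_velocity)

/-- A path in a normed algebra starting at `1` with small integral of its logarithmic derivative
stays close to `1`. -/
theorem norm_sub_one_le_of_hasDerivWithinAt {𝔸 : Type*} [NormedRing 𝔸] [NormedAlgebra ℝ 𝔸]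
    [NormOneClass 𝔸] [CompleteSpace 𝔸] {A v : ℝ → 𝔸} {w : ℝ → ℝ}
    (hA0 : A 0 = 1) (hv : ContinuousOn v (Set.Icc 0 1)) (hw : ContinuousOn w (Set.Icc 0 1))
    (hA : ∀ t ∈ Set.Icc (0 : ℝ) 1, HasDerivWithinAt A (A t * v t) (Set.Icc 0 1) t)
    (hvw : ∀ t ∈ Set.Icc (0 : ℝ) 1, ‖v t‖ ≤ w t) (hint : ∫ t in (0 : ℝ)..1, w t ≤ 1 / 2) :
    ‖A 1 - 1‖ ≤ 2 * ∫ t in (0 : ℝ)..1, w t := by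
  have hAc : ContinuousOn A (Set.Icc 0 1) := fun t ht => (hA t ht).continuousWithinAt
  -- A substitute for Grönwall: at a maximum point of `‖A - 1‖` the fundamental theorem of calculus
  -- gives `m ≤ (1 + m) * ∫ w`. Since `∫ w ≤ 1 / 2`, first `m ≤ 1`, and then `m ≤ 2 * ∫ w`.
  obtain ⟨s, hs, hmax⟩ := isCompact_Icc.exists_isMaxOn (Set.nonempty_Icc.2 zero_le_one)
    (hAc.sub (continuousOn_const (c := (1 : 𝔸)))).norm
  set m := ‖A s - 1‖ with hm
  have hle : ∀ t ∈ Set.Icc (0 : ℝ) 1, ‖A t - 1‖ ≤ m := fun t ht => hmax ht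
  have hsub : Set.Icc 0 s ⊆ Set.Icc (0 : ℝ) 1 := Set.Icc_subset_Icc_right hs.2
  have hFTC : ∫ t in (0 : ℝ)..s, A t * v t = A s - A 0 := by
    refine intervalIntegral.integral_eq_sub_of_hasDeriv_right_of_le hs.1 (hAc.mono hsub) ?_ ?_
    · intro t ht
      have ht1 : t < 1 := ht.2.trans_le hs.2
      refine (hA t ⟨ht.1.le, ht1.le⟩).mono_of_mem_nhdsWithin ?_
      exact mem_nhdsWithin_of_mem_nhds (Icc_mem_nhds ht.1 ht1)
    · refine ContinuousOn.intervalIntegrable ?_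
      rw [Set.uIcc_of_le hs.1]
      exact (hAc.mul hv).mono hsub
  have hwi : IntervalIntegrable w volume 0 1 := by
    refine ContinuousOn.intervalIntegrable ?_
    rwa [Set.uIcc_of_le zero_le_one]
  have hwis : IntervalIntegrable w volume 0 s := by
    refine ContinuousOn.intervalIntegrable ?_
    rw [Set.uIcc_of_le hs.1]
    exact hw.mono hsub
  have hm0 : 0 ≤ m := norm_nonneg _
  have h1 : m ≤ (1 + m) * ∫ t in (0 : ℝ)..s, w t := by
    rw [hm, ← hA0, ← hFTC, ← intervalIntegral.integral_const_mul]
    refine intervalIntegral.norm_integral_le_of_norm_le hs.1 ?_ (hwis.const_mul _)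
    refine Eventually.of_forall fun t ht => ?_
    have ht' := hsub (Set.Ioc_subset_Icc_self ht)
    refine (norm_mul_le _ _).trans ?_
    have hAt : ‖A t‖ ≤ 1 + m := by
      have := norm_add_le (A t - 1) 1
      rw [sub_add_cancel, norm_one] at this
      linarith [hle t ht']
    rw [hFTC, hA0, ← hm]
    exact mul_le_mul hAt (hvw t ht') (norm_nonneg _) (by positivity)
  have h2 : ∫ t in (0 : ℝ)..s, w t ≤ ∫ t in (0 : ℝ)..1, w t := by
    refine intervalIntegral.integral_mono_interval le_rfl hs.1 hs.2 ?_ hwi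
    filter_upwards [ae_restrict_mem measurableSet_Ioc] with t ht
    exact (norm_nonneg _).trans (hvw t (Set.Ioc_subset_Icc_self ht))
  have h3 : m ≤ (1 + m) * ∫ t in (0 : ℝ)..1, w t := h1.trans (by gcongr)
  have h4 := hle 1 (Set.right_mem_Icc.2 zero_le_one)
  have h5 : m ≤ 1 := by nlinarith
  have h6 : 0 ≤ ∫ t in (0 : ℝ)..1, w t := by
    by_contra hneg
    nlinarith
  nlinarith

/-- Left translation lets a short path start at the identity matrix without changing its velocity.
Its endpoint is then `O(ε)` from `1` in matrix norm, where `exists_expSL_eq` supplies a logarithm.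
-/
theorem exists_expChart_eq_of_riemannDist_le (b e : Module.Basis (Fin 3) ℝ sl2) :
    ∃ K : ℝ, 0 < K ∧ ∃ ε₀ : ℝ, 0 < ε₀ ∧ ∀ ε, 0 < ε → ε ≤ ε₀ → ∀ g : PSL(2, ℝ),
      riemannDist e 1 g ≤ ENNReal.ofReal ε → ∃ x, ‖x‖ ≤ K * ε ∧ expChart b x = g := by
  obtain ⟨K, hK, δ₀, hδ₀, hsurj⟩ := exists_expSL_eq b
  obtain ⟨N, hN, hNb⟩ := exists_norm_linearMap_le (toMatLin e)
  refine ⟨K * (4 * N), by positivity, min (1 / (4 * N)) (δ₀ / (4 * N)), by positivity,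
    fun ε hε hε₀ g hg => ?_⟩
  have hε1 : N * (2 * ε) ≤ 1 / 2 := by
    have := hε₀.trans (min_le_left _ _)
    rw [le_div_iff₀ (by positivity)] at this
    linarith
  have hε2 : 4 * N * ε ≤ δ₀ := by
    have := hε₀.trans (min_le_right _ _)
    rw [le_div_iff₀ (by positivity)] at this
    linarith
  -- The infimum of lengths need not be attained; doubling `ε > 0` makes the inequality strict and
  -- so provides a path.
  have hlt : riemannDist e 1 g < ENNReal.ofReal (2 * ε) :=
    hg.trans_lt ((ENNReal.ofReal_lt_ofReal_iff (by positivity)).2 (by linarith))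
  obtain ⟨γ, hγ⟩ := iInf_lt_iff.1 hlt
  have hvc := continuousOn_coord_velocity e γ
  have hlen : ∫ t in (0 : ℝ)..1, ‖coord e (γ.velocity t)‖ ≤ 2 * ε := by
    rw [intervalIntegral.integral_of_le zero_le_one, ← integral_Icc_eq_integral_Ioc]
    have hint : IntegrableOn (fun t => coord e (γ.velocity t)) (Set.Icc 0 1) volume :=
      hvc.integrableOn_Icc
    have h1 := ofReal_integral_norm_eq_lintegral_enorm hint
    have h2 : ENNReal.ofReal (∫ t in Set.Icc (0 : ℝ) 1, ‖coord e (γ.velocity t)‖)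
        < ENNReal.ofReal (2 * ε) := by
      rw [h1]
      exact hγ
    exact ((ENNReal.ofReal_lt_ofReal_iff (by positivity)).1 h2).le
  have h0 : QuotientGroup.mk (γ.path 0) = (1 : PSL(2, ℝ)) := γ.source
  have hmk : QuotientGroup.mk ((γ.path 0)⁻¹ * γ.path 1) = g := by
    rw [QuotientGroup.mk_mul, QuotientGroup.mk_inv, h0, inv_one, one_mul]
    exact γ.target
  have hnorm : ‖(((γ.path 0)⁻¹ * γ.path 1 : SL(2, ℝ)) : Matrix (Fin 2) (Fin 2) ℝ) - 1‖
      ≤ 4 * N * ε := by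
    have hmain := norm_sub_one_le_of_hasDerivWithinAt
      (A := fun t => (((γ.path 0)⁻¹ * γ.path t : SL(2, ℝ)) : Matrix (Fin 2) (Fin 2) ℝ))
      (v := fun t => (γ.velocity t : Matrix (Fin 2) (Fin 2) ℝ))
      (w := fun t => N * ‖coord e (γ.velocity t)‖) (by simp)
      (continuous_subtype_val.comp_continuousOn γ.continuousOn_velocity)
      (continuousOn_const.mul hvc.norm) ?_ ?_ ?_
    · rw [intervalIntegral.integral_const_mul] at hmain
      refine hmain.trans ?_
      have : N * ∫ t in (0 : ℝ)..1, ‖coord e (γ.velocity t)‖ ≤ N * (2 * ε) := by gcongr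
      linarith
    · intro t ht
      have h := (γ.hasDeriv t ht).const_mul (((γ.path 0)⁻¹ : SL(2, ℝ)) : Matrix (Fin 2) (Fin 2) ℝ)
      simp only [Matrix.SpecialLinearGroup.coe_mul, mul_assoc]
      exact h
    · intro t ht
      have h := hNb (coord e (γ.velocity t))
      have h2 : toMatLin e (coord e (γ.velocity t)) = (γ.velocity t : Matrix (Fin 2) (Fin 2) ℝ) :=
        congrArg Subtype.val (toSl_coord e _)
      rwa [h2] at h
    · rw [intervalIntegral.integral_const_mul]
      exact le_trans (by gcongr) hε1
  obtain ⟨x, hx, hxg⟩ := hsurj (4 * N * ε) hε2 _ hnorm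
  refine ⟨x, by rwa [mul_assoc], ?_⟩
  rw [expChart_eq_mk, hxg, hmk]

end Distance

/-! ### An explicit Haar measure -/

theorem measurable_SL_iff {α : Type*} [MeasurableSpace α] {f : α → SL(2, ℝ)} :
    Measurable f ↔ ∀ i j, Measurable fun x => f x i j := by
  have hcl : IsClosedEmbedding (fun (g : SL(2, ℝ)) (i j : Fin 2) => g i j) :=
    Matrix.SpecialLinearGroup.isClosedEmbedding_val
  refine hcl.measurableEmbedding.measurable_comp_iff.symm.trans ?_
  simp only [measurable_pi_iff, Function.comp_def]

/-- The element of `SL(2, ℝ)` with given first column whose second column is a given multiple of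
the first one plus `(0, 1 / a)`. -/
noncomputable def shearSLOfNe (p : (Fin 2 → ℝ) × ℝ) (h : p.1 0 ≠ 0) : SL(2, ℝ) :=
  ⟨!![p.1 0, p.2 * p.1 0; p.1 1, (p.1 0)⁻¹ + p.2 * p.1 1], by
    rw [Matrix.det_fin_two_of]
    field_simp
    ring⟩

open scoped Classical in
/-- Coordinates on `SL(2, ℝ)`: the inverse of `colShear`. It is the identity if `a = 0`. -/
noncomputable def shearSL (p : (Fin 2 → ℝ) × ℝ) : SL(2, ℝ) :=
  if h : p.1 0 ≠ 0 then shearSLOfNe p h else 1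

theorem coe_shearSL {p : (Fin 2 → ℝ) × ℝ} (h : p.1 0 ≠ 0) :
    (shearSL p : Matrix (Fin 2) (Fin 2) ℝ)
      = !![p.1 0, p.2 * p.1 0; p.1 1, (p.1 0)⁻¹ + p.2 * p.1 1] := by
  rw [shearSL, dif_pos h]
  rfl

theorem measurable_shearSL : Measurable shearSL := by
  have h0 : MeasurableSet {p : (Fin 2 → ℝ) × ℝ | p.1 0 ≠ 0} :=
    (measurableSet_eq_fun (by fun_prop) (by fun_prop)).compl
  have key : ∀ i j, (fun p => shearSL p i j) = fun p : (Fin 2 → ℝ) × ℝ => if p.1 0 ≠ 0 then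
      (!![p.1 0, p.2 * p.1 0; p.1 1, (p.1 0)⁻¹ + p.2 * p.1 1] : Matrix (Fin 2) (Fin 2) ℝ) i j
      else (1 : Matrix (Fin 2) (Fin 2) ℝ) i j := by
    intro i j
    funext p
    by_cases h : p.1 0 ≠ 0
    · rw [if_pos h, coe_shearSL h]
    · rw [if_neg h, shearSL, dif_neg h]
      rfl
  rw [measurable_SL_iff]
  intro i j
  rw [key]
  refine Measurable.ite h0 ?_ measurable_const
  fin_cases i <;> fin_cases j <;> simp <;> fun_prop

theorem shearSL_colShear {g : SL(2, ℝ)} (hg : g 0 0 ≠ 0) :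
    shearSL (colShear (g : Matrix (Fin 2) (Fin 2) ℝ)) = g := by
  have hg' : (colShear (g : Matrix (Fin 2) (Fin 2) ℝ)).1 0 ≠ 0 := hg
  refine (eq_of_colShear_eq hg ?_).symm
  rw [coe_shearSL hg']
  ext i
  · fin_cases i <;> simp [colShear]
  · simp [colShear, hg]

theorem colShear_shearSL {p : (Fin 2 → ℝ) × ℝ} (h : p.1 0 ≠ 0) :
    colShear (shearSL p : Matrix (Fin 2) (Fin 2) ℝ) = p := by
  rw [coe_shearSL h]
  ext i
  · fin_cases i <;> simp [colShear]
  · simp [colShear, h]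

/-- The exceptional set is the kernel of a nonzero linear functional, a proper subspace. -/
theorem volume_apply_zero_eq_zero (h : Matrix (Fin 2) (Fin 2) ℝ) (hh : h.det ≠ 0) :
    ∀ᵐ p : (Fin 2 → ℝ) × ℝ, (h *ᵥ p.1) 0 ≠ 0 := by
  let φ : (Fin 2 → ℝ) × ℝ →ₗ[ℝ] ℝ :=
    LinearMap.proj 0 ∘ₗ Matrix.toLin' h ∘ₗ LinearMap.fst ℝ (Fin 2 → ℝ) ℝ
  have hφ : LinearMap.ker φ ≠ ⊤ := by
    intro htop
    have h1 : ∀ v : Fin 2 → ℝ, (h *ᵥ v) 0 = 0 := fun v =>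
      LinearMap.mem_ker.1 (htop ▸ Submodule.mem_top : ((v, 0) : (Fin 2 → ℝ) × ℝ) ∈ LinearMap.ker φ)
    have h2 := h1 (h⁻¹ *ᵥ Pi.single 0 1)
    rw [Matrix.mulVec_mulVec, Matrix.mul_nonsing_inv _ (isUnit_iff_ne_zero.2 hh),
      Matrix.one_mulVec] at h2
    simp at h2
  have hH : (volume : Measure ((Fin 2 → ℝ) × ℝ)).IsAddHaarMeasure :=
    inferInstanceAs
      (((volume : Measure (Fin 2 → ℝ)).prod (volume : Measure ℝ)).IsAddHaarMeasure)
  have := Measure.addHaar_submodule (volume : Measure ((Fin 2 → ℝ) × ℝ)) (LinearMap.ker φ) hφ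
  rw [ae_iff]
  convert this using 2
  ext p
  simp [φ]

theorem ae_apply_zero_ne_zero : ∀ᵐ p : (Fin 2 → ℝ) × ℝ, p.1 0 ≠ 0 := by
  simpa using volume_apply_zero_eq_zero 1 (by simp)

/-- Left multiplication in the coordinates of `shearSL`. -/
noncomputable def shearMul (h : SL(2, ℝ)) (p : (Fin 2 → ℝ) × ℝ) : (Fin 2 → ℝ) × ℝ :=
  (Matrix.toLin' (h : Matrix (Fin 2) (Fin 2) ℝ) p.1,
    p.2 + h 0 1 / (p.1 0 * Matrix.toLin' (h : Matrix (Fin 2) (Fin 2) ℝ) p.1 0))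

/-- With columns `v` and `τ v + (0, 1 / v₀)`, multiplication by `h` acts linearly on `v`. The ratio
of the entries in the first row shows that `τ` is shifted by an amount depending on `v` alone. -/
theorem mul_shearSL (h : SL(2, ℝ)) {p : (Fin 2 → ℝ) × ℝ} (hp : p.1 0 ≠ 0)
    (hhp : ((h : Matrix (Fin 2) (Fin 2) ℝ) *ᵥ p.1) 0 ≠ 0) :
    h * shearSL p = shearSL (shearMul h p) := by
  have hp' : (shearMul h p).1 0 ≠ 0 := hhp
  have d := h.det_coe
  rw [Matrix.det_fin_two] at d
  have h00 : (h * shearSL p) 0 0 = (shearMul h p).1 0 := by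
    rw [Matrix.SpecialLinearGroup.coe_mul, coe_shearSL hp]
    simp [shearMul, Matrix.mul_apply, Fin.sum_univ_two, Matrix.mulVec, dotProduct]
  refine eq_of_colShear_eq (by rwa [h00]) ?_
  rw [colShear_shearSL hp', Matrix.SpecialLinearGroup.coe_mul, coe_shearSL hp]
  simp only [Matrix.mulVec, dotProduct, Fin.sum_univ_two] at hhp
  ext i
  · fin_cases i <;>
      simp [colShear, shearMul, Matrix.mul_apply, Fin.sum_univ_two, Matrix.mulVec, dotProduct]
  · simp only [colShear, shearMul, Matrix.mul_apply, Fin.sum_univ_two, Matrix.mulVec, dotProduct,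
      Matrix.toLin'_apply]
    simp
    field_simp
    ring

/-- A linear map of determinant one in the base followed by a translation in each fibre. This is why
Lebesgue measure in these coordinates is left invariant. -/
theorem measurePreserving_shearMul (h : SL(2, ℝ)) :
    MeasurePreserving (shearMul h) volume volume := by
  refine MeasurePreserving.skew_product (f := Matrix.toLin' (h : Matrix (Fin 2) (Fin 2) ℝ))
    (g := fun v τ => τ + h 0 1 / (v 0 * Matrix.toLin' (h : Matrix (Fin 2) (Fin 2) ℝ) v 0))
    ⟨?_, ?_⟩ ?_ ?_
  · exact (LinearMap.continuous_of_finiteDimensional _).measurable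
  · rw [Real.map_matrix_volume_pi_eq_smul_volume_pi (by simp [h.det_coe])]
    simp [h.det_coe]
  · have h1 : Measurable (Matrix.toLin' (h : Matrix (Fin 2) (Fin 2) ℝ)) :=
      (LinearMap.continuous_of_finiteDimensional _).measurable
    have h2 : Measurable fun p : (Fin 2 → ℝ) × ℝ =>
        Matrix.toLin' (h : Matrix (Fin 2) (Fin 2) ℝ) p.1 0 :=
      (measurable_pi_apply 0).comp (h1.comp measurable_fst)
    have h3 : Measurable fun p : (Fin 2 → ℝ) × ℝ => p.1 0 :=
      (measurable_pi_apply 0).comp measurable_fst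
    exact measurable_snd.add (measurable_const.div (h3.mul h2))
  · exact Eventually.of_forall fun v => map_add_right_eq_self volume _

/-- The image of `shearSL` in `PSL(2, ℝ)`. -/
noncomputable def shearPSL (p : (Fin 2 → ℝ) × ℝ) : PSL(2, ℝ) := QuotientGroup.mk (shearSL p)

theorem measurable_shearPSL : Measurable shearPSL :=
  measurable_quotient_mk''.comp measurable_shearSL

/-- An explicit Haar measure on `PSL(2, ℝ)`. -/
noncomputable def shearHaar : Measure PSL(2, ℝ) := Measure.map shearPSL volume

instance isMulLeftInvariant_shearHaar : shearHaar.IsMulLeftInvariant := by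
  refine ⟨fun g => ?_⟩
  obtain ⟨h, rfl⟩ := QuotientGroup.mk_surjective g
  rw [shearHaar, Measure.map_map (measurable_const_mul _) measurable_shearPSL]
  have hdet : (h : Matrix (Fin 2) (Fin 2) ℝ).det ≠ 0 := by simp [h.det_coe]
  have hae : (fun x => (QuotientGroup.mk h : PSL(2, ℝ)) * x) ∘ shearPSL
      =ᵐ[volume] shearPSL ∘ shearMul h := by
    filter_upwards [ae_apply_zero_ne_zero,
      volume_apply_zero_eq_zero (h : Matrix (Fin 2) (Fin 2) ℝ) hdet] with p hp hhp
    simp only [Function.comp_apply, shearPSL]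
    rw [← QuotientGroup.mk_mul, mul_shearSL h hp hhp]
  rw [Measure.map_congr hae, ← Measure.map_map measurable_shearPSL
    (measurePreserving_shearMul h).measurable, (measurePreserving_shearMul h).map_eq]

theorem mk_eq_mk_iff (g h : SL(2, ℝ)) : (QuotientGroup.mk g : PSL(2, ℝ)) = QuotientGroup.mk h ↔
    g = h ∨ g = -h := by
  constructor
  · intro hgh
    obtain ⟨r, hr, hr'⟩ := Matrix.SpecialLinearGroup.mem_center_iff.1 (QuotientGroup.eq.1 hgh)
    have h1 : (h : Matrix (Fin 2) (Fin 2) ℝ) = r • (g : Matrix (Fin 2) (Fin 2) ℝ) := by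
      have h3 : (h : Matrix (Fin 2) (Fin 2) ℝ)
          = (g : Matrix (Fin 2) (Fin 2) ℝ) * ((g⁻¹ * h : SL(2, ℝ)) : Matrix (Fin 2) (Fin 2) ℝ) := by
        rw [← Matrix.SpecialLinearGroup.coe_mul, mul_inv_cancel_left]
      rw [h3, ← hr', Matrix.scalar_apply, ← Matrix.smul_one_eq_diagonal, mul_smul_comm, mul_one]
    rw [Fintype.card_fin] at hr
    rcases mul_self_eq_one_iff.1 ((sq r).symm.trans hr) with hr1 | hr1
    · left
      apply Subtype.ext
      rw [h1, hr1, one_smul]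
    · right
      apply Subtype.ext
      rw [Matrix.SpecialLinearGroup.coe_neg, h1, hr1]
      simp
  · rintro (rfl | rfl)
    · rfl
    · rw [QuotientGroup.eq, Matrix.SpecialLinearGroup.mem_center_iff]
      refine ⟨-1, by simp, ?_⟩
      rw [Matrix.SpecialLinearGroup.coe_mul]
      have hh : ((-h)⁻¹ : SL(2, ℝ)) = -h⁻¹ := by
        rw [inv_eq_iff_mul_eq_one]
        simp
      rw [hh, Matrix.SpecialLinearGroup.coe_neg, neg_mul, ← Matrix.SpecialLinearGroup.coe_mul,
        inv_mul_cancel, Matrix.SpecialLinearGroup.coe_one, map_neg, map_one]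

/-- Reversing the sign of the first column reverses the sign of `shearSL`. -/
theorem shearPSL_neg (p : (Fin 2 → ℝ) × ℝ) : shearPSL (-p.1, p.2) = shearPSL p := by
  by_cases h : p.1 0 ≠ 0
  · have h' : ((-p.1, p.2) : (Fin 2 → ℝ) × ℝ).1 0 ≠ 0 := by simpa using h
    refine (mk_eq_mk_iff _ _).2 (Or.inr ?_)
    apply Subtype.ext
    rw [Matrix.SpecialLinearGroup.coe_neg, coe_shearSL h, coe_shearSL h']
    ext i j
    fin_cases i <;> fin_cases j <;> simp [inv_neg]
    ring
  · have h' : ¬ ((-p.1, p.2) : (Fin 2 → ℝ) × ℝ).1 0 ≠ 0 := by simpa using h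
    rw [shearPSL, shearPSL, shearSL, shearSL, dif_neg h, dif_neg h']

/-- The factor `2` counts the two lifts `±h` of an element of `PSL(2, ℝ)`. The part of the preimage
with positive upper left entry is the set of coordinates of the exponentials; up to a null set the
rest is its reflection `v ↦ -v`. -/
theorem shearHaar_image_expChart (b : Module.Basis (Fin 3) ℝ sl2) {E : Set E3}
    (hpos : ∀ x ∈ E, 0 < expSL b x 0 0) (hE : MeasurableSet (expChart b '' E)) :
    shearHaar (expChart b '' E)
      = 2 * volume ((fun x => colShear (expSL b x : Matrix (Fin 2) (Fin 2) ℝ)) '' E) := by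
  set S := (fun x => colShear (expSL b x : Matrix (Fin 2) (Fin 2) ℝ)) '' E with hS
  set U := shearPSL ⁻¹' (expChart b '' E) with hU
  have hUm : MeasurableSet U := measurable_shearPSL hE
  have hP : MeasurableSet {p : (Fin 2 → ℝ) × ℝ | 0 < p.1 0} :=
    measurableSet_lt measurable_const ((measurable_pi_apply 0).comp measurable_fst)
  have hUS : U ∩ {p | 0 < p.1 0} = S := by
    ext p
    constructor
    · rintro ⟨⟨x, hx, hxp⟩, hp⟩
      have hp' : p.1 0 ≠ 0 := ne_of_gt (show 0 < p.1 0 from hp)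
      refine ⟨x, hx, ?_⟩
      have hx0 := hpos x hx
      rw [expChart_eq_mk, shearPSL, mk_eq_mk_iff] at hxp
      rcases hxp with h | h
      · simp only [h, colShear_shearSL hp']
      · rw [h, Matrix.SpecialLinearGroup.coe_neg, coe_shearSL hp'] at hx0
        have hp2 : 0 < p.1 0 := hp
        simp at hx0
        linarith
    · rintro ⟨x, hx, rfl⟩
      exact ⟨⟨x, hx, by rw [shearPSL, shearSL_colShear (hpos x hx).ne', expChart_eq_mk]⟩,
        hpos x hx⟩
  have hneg : MeasurePreserving (fun p : (Fin 2 → ℝ) × ℝ => (-p.1, p.2)) volume volume :=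
    (Measure.measurePreserving_neg (volume : Measure (Fin 2 → ℝ))).prod
      (MeasurePreserving.id (volume : Measure ℝ))
  have hUN : volume (U ∩ {p | 0 < p.1 0}ᶜ) = volume S := by
    rw [← hUS, ← hneg.measure_preimage (hUm.inter hP).nullMeasurableSet]
    apply measure_congr
    filter_upwards [ae_apply_zero_ne_zero] with p hp
    apply propext
    have h1 : (-p.1, p.2) ∈ U ↔ p ∈ U := by
      rw [hU, Set.mem_preimage, shearPSL_neg, Set.mem_preimage]
    have h2 : ¬ (0 < p.1 0) ↔ 0 < (-p.1) 0 := by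
      rw [Pi.neg_apply, neg_pos, not_lt]
      exact ⟨fun h => lt_of_le_of_ne h hp, le_of_lt⟩
    change (p ∈ U ∧ ¬ (0 < p.1 0)) ↔ ((-p.1, p.2) ∈ U ∧ 0 < (-p.1) 0)
    rw [h1, h2]
  rw [shearHaar, Measure.map_apply measurable_shearPSL hE, ← hU, ← measure_inter_add_sdiff U hP,
    Set.sdiff_eq, hUN, hUS, two_mul]

/-! ### The normalised Haar measure in exponential coordinates -/

/-- Compare volumes: the image of the unit ball lies in the ball of radius `‖A‖`. -/
theorem abs_det_le_norm_pow {E : Type*} [NormedAddCommGroup E] [NormedSpace ℝ E]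
    [FiniteDimensional ℝ E] [MeasurableSpace E] [BorelSpace E] (A : E →L[ℝ] E) :
    |A.det| ≤ ‖A‖ ^ Module.finrank ℝ E := by
  let μ : Measure E := Measure.addHaar
  have h1 := μ.addHaar_image_continuousLinearMap A (Metric.closedBall 0 1)
  have h2 : A '' Metric.closedBall 0 1 ⊆ Metric.closedBall 0 ‖A‖ := by
    rintro _ ⟨x, hx, rfl⟩
    rw [mem_closedBall_zero_iff] at hx ⊢
    exact (A.le_opNorm x).trans (mul_le_of_le_one_right (norm_nonneg _) hx)
  have h3 := measure_mono (μ := μ) h2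
  rw [h1, μ.addHaar_closedBall' (0 : E) (norm_nonneg A)] at h3
  have hpos : μ (Metric.closedBall (0 : E) 1) ≠ 0 :=
    (Metric.measure_closedBall_pos μ 0 one_pos).ne'
  have hfin : μ (Metric.closedBall (0 : E) 1) ≠ ∞ := measure_closedBall_lt_top.ne
  rw [ENNReal.mul_le_mul_iff_left hpos hfin] at h3
  exact (ENNReal.ofReal_le_ofReal_iff (by positivity)).1 h3

/-- The Jacobian of `chartMap`. -/
noncomputable def chartJac (b : Module.Basis (Fin 3) ℝ sl2) (x : E3) : ℝ≥0∞ :=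
  ENNReal.ofReal |(fderiv ℝ (chartMap b) x).det|

theorem exists_chartMap_bounds (b : Module.Basis (Fin 3) ℝ sl2) :
    ∃ C : ℝ, 0 < C ∧ ∃ r₀ : ℝ, 0 < r₀ ∧
      (∀ x, ‖x‖ ≤ r₀ → chartJac b x ≤ ENNReal.ofReal (1 + C * ‖x‖)) ∧
      ∀ E ⊆ Metric.closedBall (0 : E3) r₀, MeasurableSet E →
        volume (chartMap b '' E) = ∫⁻ x in E, chartJac b x := by
  obtain ⟨C, hC, r₀, hr₀, hder, hlin⟩ :=
    exists_norm_sub_sub_le_of_contDiffAt (contDiffAt_chartMap b) (hasFDerivAt_chartMap b)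
  set r₁ := min (min r₀ 1) (1 / (2 * C)) with hr₁
  have hr₁r₀ : r₁ ≤ r₀ := (min_le_left _ _).trans (min_le_left _ _)
  have hr₁1 : r₁ ≤ 1 := (min_le_left _ _).trans (min_le_right _ _)
  have hCr : C * r₁ ≤ 1 / 2 := by
    calc C * r₁ ≤ C * (1 / (2 * C)) := by gcongr; exact min_le_right _ _
      _ = 1 / 2 := by field_simp
  -- The coefficients of `(1 + C * ‖x‖) ^ 3 - 1`, with higher powers of `‖x‖ ≤ 1` bounded by `‖x‖`.
  refine ⟨3 * C + 3 * C ^ 2 + C ^ 3, by positivity, r₁, by positivity, fun x hx => ?_,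
    fun E hE hEm => ?_⟩
  · apply ENNReal.ofReal_le_ofReal
    refine (abs_det_le_norm_pow _).trans ?_
    have h1 : ‖fderiv ℝ (chartMap b) x‖ ≤ 1 + C * ‖x‖ := by
      have h2 := (hder x (hx.trans hr₁r₀)).2
      have h3 := norm_add_le (fderiv ℝ (chartMap b) x - ContinuousLinearMap.id ℝ E3)
        (ContinuousLinearMap.id ℝ E3)
      rw [sub_add_cancel] at h3
      have h4 : ‖ContinuousLinearMap.id ℝ E3‖ ≤ 1 := ContinuousLinearMap.norm_id_le
      linarith
    rw [finrank_euclideanSpace_fin]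
    refine (pow_le_pow_left₀ (norm_nonneg _) h1 3).trans ?_
    have h5 : ‖x‖ ≤ 1 := hx.trans hr₁1
    have h6 := norm_nonneg x
    have h7 : ‖x‖ ^ 2 ≤ ‖x‖ := by nlinarith
    have h8 : ‖x‖ ^ 3 ≤ ‖x‖ := by nlinarith
    have h9 : C ^ 2 * ‖x‖ ^ 2 ≤ C ^ 2 * ‖x‖ := by gcongr
    have h10 : C ^ 3 * ‖x‖ ^ 3 ≤ C ^ 3 * ‖x‖ := by gcongr
    linarith
  · refine (lintegral_abs_det_fderiv_eq_addHaar_image volume hEm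
      (fun x hx => ((hder x ?_).1.hasFDerivAt).hasFDerivWithinAt) ?_).symm
    · exact (mem_closedBall_zero_iff.1 (hE hx)).trans hr₁r₀
    -- Injectivity: if the images agree, the linearisation error, at most half of `‖x - y‖`, must
    -- equal `‖x - y‖`.
    · intro x hx y hy hxy
      have h := hlin r₁ hr₁r₀ x y (mem_closedBall_zero_iff.1 (hE hx))
        (mem_closedBall_zero_iff.1 (hE hy))
      rw [hxy, sub_self, zero_sub, norm_neg] at h
      simp only [ContinuousLinearMap.coe_id', id_eq] at h
      have h2 : C * r₁ * ‖x - y‖ ≤ 1 / 2 * ‖x - y‖ := by gcongr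
      have h3 : ‖x - y‖ = 0 := le_antisymm (by linarith) (norm_nonneg _)
      exact sub_eq_zero.1 (norm_eq_zero.1 h3)

theorem tendsto_chartJac (b : Module.Basis (Fin 3) ℝ sl2) :
    Tendsto (chartJac b) (𝓝 0) (𝓝 1) := by
  have h1 : ContinuousAt (fderiv ℝ (chartMap b)) 0 :=
    ((contDiffAt_chartMap b).fderiv_right (m := 1) (by norm_num)).continuousAt
  have h2 : ContinuousAt (chartJac b) 0 :=
    (ENNReal.continuous_ofReal.comp (continuous_abs.comp
      ContinuousLinearMap.continuous_det)).continuousAt.comp h1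
  have h3 : chartJac b 0 = 1 := by
    rw [chartJac, (hasFDerivAt_chartMap b).fderiv]
    have : (ContinuousLinearMap.id ℝ E3).det = 1 := LinearMap.det_id
    simp [this]
  rw [← h3]
  exact h2

/-- The ratio is the average over a shrinking ball of a Jacobian that tends to `1` at the centre. -/
theorem tendsto_volume_chartMap_ball (b : Module.Basis (Fin 3) ℝ sl2) :
    Tendsto (fun r => volume (chartMap b '' Metric.ball 0 r) / volume (Metric.ball (0 : E3) r))
      (𝓝[>] 0) (𝓝 1) := by
  obtain ⟨C, hC, r₀, hr₀, -, hvol⟩ := exists_chartMap_bounds b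
  have hball : ∀ {s : Set E3}, s ∈ 𝓝 (0 : E3) → ∀ᶠ r in 𝓝[>] (0 : ℝ),
      0 < r ∧ Metric.ball 0 r ⊆ s ∧ volume (chartMap b '' Metric.ball 0 r)
        = ∫⁻ x in Metric.ball 0 r, chartJac b x := by
    intro s hs
    obtain ⟨ρ, hρ, hρs⟩ := Metric.mem_nhds_iff.1 hs
    filter_upwards [Ioo_mem_nhdsGT (lt_min hρ hr₀)] with r hr
    refine ⟨hr.1, (Metric.ball_subset_ball (hr.2.le.trans (min_le_left _ _))).trans hρs,
      hvol _ ?_ measurableSet_ball⟩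
    exact (Metric.ball_subset_ball (hr.2.le.trans (min_le_right _ _))).trans
      Metric.ball_subset_closedBall
  have hv0 : ∀ {r : ℝ}, 0 < r → volume (Metric.ball (0 : E3) r) ≠ 0 := fun hr =>
    (Metric.measure_ball_pos volume 0 hr).ne'
  have hvt : ∀ {r : ℝ}, volume (Metric.ball (0 : E3) r) ≠ ∞ := measure_ball_lt_top.ne
  refine tendsto_order.2 ⟨fun a ha => ?_, fun a ha => ?_⟩
  · obtain ⟨a', haa', ha'⟩ := exists_between ha
    filter_upwards [hball ((tendsto_order.1 (tendsto_chartJac b)).1 a' ha')] with r hr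
    refine haa'.trans_le ?_
    rw [ENNReal.le_div_iff_mul_le (Or.inl (hv0 hr.1)) (Or.inl hvt), hr.2.2,
      ← setLIntegral_const]
    exact setLIntegral_mono' measurableSet_ball fun x hx => (hr.2.1 hx).le
  · obtain ⟨a', ha', haa'⟩ := exists_between ha
    filter_upwards [hball ((tendsto_order.1 (tendsto_chartJac b)).2 a' ha')] with r hr
    refine lt_of_le_of_lt ?_ haa'
    rw [ENNReal.div_le_iff_le_mul (Or.inl (hv0 hr.1)) (Or.inl hvt), hr.2.2,
      ← setLIntegral_const]
    exact setLIntegral_mono' measurableSet_ball fun x hx => (hr.2.1 hx).le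

/-- The constant combines the two sheets with the scaling of Lebesgue measure by `chartLin`. Its
value is irrelevant, as the normalisation of `haarPSL` cancels it. -/
theorem exists_shearHaar_image_eq (b : Module.Basis (Fin 3) ℝ sl2) :
    ∃ c : ℝ≥0∞, c ≠ 0 ∧ c ≠ ∞ ∧ ∃ r₀ : ℝ, 0 < r₀ ∧
      ∀ E ⊆ Metric.closedBall (0 : E3) r₀, MeasurableSet E →
        shearHaar (expChart b '' E) = c * volume (chartMap b '' E) := by
  have hH : (volume : Measure ((Fin 2 → ℝ) × ℝ)).IsAddHaarMeasure :=
    inferInstanceAs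
      (((volume : Measure (Fin 2 → ℝ)).prod (volume : Measure ℝ)).IsAddHaarMeasure)
  set ν : Measure E3 := Measure.map (chartLin b).symm volume with hν
  have hνH : ν.IsAddHaarMeasure := (chartLin b).symm.isAddHaarMeasure_map volume
  obtain ⟨r₁, hr₁, hlog, -⟩ := exists_logChart_expChart b
  have hpos : ∀ᶠ x in 𝓝 (0 : E3), 0 < expSL b x 0 0 := by
    have hc : Continuous fun x => expSL b x 0 0 :=
      (continuous_subtype_val.comp (continuous_expSL b)).matrix_elem 0 0
    exact continuousAt_const.eventually_lt hc.continuousAt (by simp [expSL_zero])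
  obtain ⟨r₂, hr₂, hr₂pos⟩ := Metric.nhds_basis_closedBall.mem_iff.1 hpos
  refine ⟨2 * (Measure.addHaarScalarFactor ν volume : ℝ≥0∞), ?_, ?_, min r₁ r₂, by positivity,
    fun E hE hEm => ?_⟩
  · exact mul_ne_zero two_ne_zero (ENNReal.coe_ne_zero.2
      (Measure.addHaarScalarFactor_pos_of_isAddHaarMeasure ν volume).ne')
  · exact ENNReal.mul_ne_top ENNReal.ofNat_ne_top ENNReal.coe_ne_top
  · have hE1 : ∀ x ∈ E, toSl b x ∈ logTarget := fun x hx =>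
      hlog x ((mem_closedBall_zero_iff.1 (hE hx)).trans (min_le_left _ _))
    have hE2 : ∀ x ∈ E, 0 < expSL b x 0 0 := fun x hx =>
      hr₂pos (Metric.closedBall_subset_closedBall (min_le_right _ _) (hE hx))
    have him : MeasurableSet (expChart b '' E) :=
      hEm.image_of_continuousOn_injOn (continuous_expChart b).continuousOn
        ((expChart_injOn b).mono hE1)
    have h1 : (fun x => colShear (expSL b x : Matrix (Fin 2) (Fin 2) ℝ)) '' E
        = (chartLin b).symm ⁻¹' (chartMap b '' E) := by
      ext p
      constructor
      · rintro ⟨x, hx, rfl⟩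
        exact ⟨x, hx, rfl⟩
      · rintro ⟨x, hx, hxp⟩
        exact ⟨x, hx, (chartLin b).symm.injective hxp⟩
    have h2 : volume ((chartLin b).symm ⁻¹' (chartMap b '' E)) = ν (chartMap b '' E) :=
      ((chartLin b).symm.toHomeomorph.measurableEmbedding.map_apply _ _).symm
    have h3 : ν (chartMap b '' E)
        = (Measure.addHaarScalarFactor ν volume : ℝ≥0∞) * volume (chartMap b '' E) := by
      conv_lhs => rw [Measure.isAddLeftInvariant_eq_smul ν volume]
      rfl
    rw [shearHaar_image_expChart b hE2 him, h1, h2, h3, mul_assoc]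

section

open scoped Matrix.Norms.Operator

theorem expChart_image_closedBall_mem_nhds (b : Module.Basis (Fin 3) ℝ sl2) {r : ℝ} (hr : 0 < r) :
    expChart b '' Metric.closedBall 0 r ∈ 𝓝 (1 : PSL(2, ℝ)) := by
  obtain ⟨K, hK, δ₀, hδ₀, hsurj⟩ := exists_expSL_eq b
  have hδ : 0 < min δ₀ (r / K) := by positivity
  have h1 : {h : SL(2, ℝ) | ‖(h : Matrix (Fin 2) (Fin 2) ℝ) - 1‖ < min δ₀ (r / K)}
      ∈ 𝓝 (1 : SL(2, ℝ)) := by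
    have hc : Continuous fun h : SL(2, ℝ) => ‖(h : Matrix (Fin 2) (Fin 2) ℝ) - 1‖ :=
      (continuous_subtype_val.sub continuous_const).norm
    exact hc.continuousAt.eventually_lt continuousAt_const (by simpa using hδ)
  have h2 := QuotientGroup.isOpenQuotientMap_mk (N := Subgroup.center SL(2, ℝ))
    |>.isOpenMap.image_mem_nhds h1
  refine mem_of_superset h2 ?_
  rintro _ ⟨h, hh, rfl⟩
  obtain ⟨x, hx, rfl⟩ := hsurj _ (min_le_left _ _) h (le_of_lt hh)
  refine ⟨x, mem_closedBall_zero_iff.2 (hx.trans ?_), rfl⟩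
  calc K * min δ₀ (r / K) ≤ K * (r / K) := by gcongr; exact min_le_right _ _
    _ = r := by field_simp

end

/-- For a left invariant measure it is enough to find one compact set with nonempty interior and
finite, nonzero mass. A small exponential ball works: the volume ratio tends to `1`, and the
Jacobian is bounded. -/
theorem isHaarMeasure_shearHaar (b : Module.Basis (Fin 3) ℝ sl2) : shearHaar.IsHaarMeasure := by
  obtain ⟨c, hc0, hct, r₀, hr₀, himg⟩ := exists_shearHaar_image_eq b
  obtain ⟨C, hC, r₁, hr₁, hbound, hvol⟩ := exists_chartMap_bounds b
  have hev := (tendsto_order.1 (tendsto_volume_chartMap_ball b)).1 0 one_pos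
  obtain ⟨r, hrpos, hr0, hrr⟩ :=
    (hev.and (Ioo_mem_nhdsGT (lt_min hr₀ hr₁))).exists
  have hr₀' : Metric.closedBall (0 : E3) r ⊆ Metric.closedBall 0 r₀ :=
    Metric.closedBall_subset_closedBall (hrr.le.trans (min_le_left _ _))
  have hr₁' : Metric.closedBall (0 : E3) r ⊆ Metric.closedBall 0 r₁ :=
    Metric.closedBall_subset_closedBall (hrr.le.trans (min_le_right _ _))
  refine Measure.isHaarMeasure_of_isCompact_nonempty_interior _
    (expChart b '' Metric.closedBall 0 r)
    ((isCompact_closedBall 0 r).image (continuous_expChart b))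
    ⟨1, mem_interior_iff_mem_nhds.2 (expChart_image_closedBall_mem_nhds b hr0)⟩ ?_ ?_
  · rw [himg _ hr₀' measurableSet_closedBall]
    refine mul_ne_zero hc0 fun h => ?_
    have h2 : volume (chartMap b '' Metric.ball 0 r) = 0 :=
      measure_mono_null (Set.image_mono Metric.ball_subset_closedBall) h
    rw [h2, ENNReal.zero_div] at hrpos
    exact lt_irrefl _ hrpos
  · rw [himg _ hr₀' measurableSet_closedBall, hvol _ hr₁' measurableSet_closedBall]
    refine ENNReal.mul_ne_top hct (ne_of_lt ?_)
    calc ∫⁻ x in Metric.closedBall 0 r, chartJac b x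
        ≤ ∫⁻ _ in Metric.closedBall (0 : E3) r, ENNReal.ofReal (1 + C * r₁) := by
          refine setLIntegral_mono' measurableSet_closedBall fun x hx => ?_
          have hx1 : ‖x‖ ≤ r₁ := mem_closedBall_zero_iff.1 (hr₁' hx)
          exact (hbound x hx1).trans (ENNReal.ofReal_le_ofReal (by gcongr))
      _ < ∞ := by
          rw [setLIntegral_const]
          exact ENNReal.mul_lt_top ENNReal.ofReal_lt_top measure_closedBall_lt_top

/-- Haar measures are proportional, so `shearHaar` computes the mass of small exponential balls. The
`limUnder` in `haarPSL` is therefore a true limit, `(s * c)⁻¹`, which exactly removes all scalar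
factors. -/
theorem exists_haarPSL_eq (b : Module.Basis (Fin 3) ℝ sl2) :
    (∃ a : ℝ≥0∞, a ≠ ∞ ∧ haarPSL b = a • (Measure.haar : Measure PSL(2, ℝ))) ∧
    ∃ r₀ : ℝ, 0 < r₀ ∧ ∀ E ⊆ Metric.closedBall (0 : E3) r₀, MeasurableSet E →
        haarPSL b (expChart b '' E) = volume (chartMap b '' E) := by
  have hH := isHaarMeasure_shearHaar b
  obtain ⟨c, hc0, hct, r₀, hr₀, himg⟩ := exists_shearHaar_image_eq b
  set s : ℝ≥0∞ := (Measure.haarScalarFactor (Measure.haar : Measure PSL(2, ℝ)) shearHaar : ℝ≥0∞)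
    with hs
  have hs0 : s ≠ 0 := ENNReal.coe_ne_zero.2
    (Measure.haarScalarFactor_pos_of_isHaarMeasure _ _).ne'
  have hst : s ≠ ∞ := ENNReal.coe_ne_top
  have hhaar : ∀ E ⊆ Metric.closedBall (0 : E3) r₀, MeasurableSet E →
      (Measure.haar : Measure PSL(2, ℝ)) (expChart b '' E)
        = s * c * volume (chartMap b '' E) := by
    intro E hE hEm
    rw [mul_assoc, ← himg E hE hEm]
    conv_lhs => rw [Measure.isMulLeftInvariant_eq_smul Measure.haar shearHaar]
    rfl
  have hsc0 : s * c ≠ 0 := mul_ne_zero hs0 hc0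
  have hsct : s * c ≠ ∞ := ENNReal.mul_ne_top hst hct
  have hlim : Tendsto (fun r : ℝ =>
      (volume (Metric.ball (0 : EuclideanSpace ℝ (Fin 3)) r)
        / Measure.haar (expBall b r) : ℝ≥0∞)) (𝓝[>] 0) (𝓝 (s * c)⁻¹) := by
    have h1 : Tendsto (fun r => (s * c)⁻¹ * (volume (chartMap b '' Metric.ball 0 r)
        / volume (Metric.ball (0 : E3) r))⁻¹) (𝓝[>] 0) (𝓝 ((s * c)⁻¹ * 1⁻¹)) :=
      ENNReal.Tendsto.const_mul (tendsto_inv_iff.2 (tendsto_volume_chartMap_ball b))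
        (Or.inl (by simp))
    rw [inv_one, mul_one] at h1
    refine h1.congr' ?_
    filter_upwards [Ioo_mem_nhdsGT hr₀] with r hr
    have hv0 : volume (Metric.ball (0 : E3) r) ≠ 0 := (Metric.measure_ball_pos volume 0 hr.1).ne'
    have hvt : volume (Metric.ball (0 : E3) r) ≠ ∞ := measure_ball_lt_top.ne
    rw [expBall_eq, hhaar _ (Metric.ball_subset_closedBall.trans
      (Metric.closedBall_subset_closedBall hr.2.le)) measurableSet_ball,
      ENNReal.inv_div (Or.inl hvt) (Or.inl hv0), div_eq_mul_inv, div_eq_mul_inv,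
      ENNReal.mul_inv (Or.inl hsc0) (Or.inl hsct)]
    ring
  have hPSL : haarPSL b = (s * c)⁻¹ • (Measure.haar : Measure PSL(2, ℝ)) := by
    rw [haarPSL, hlim.limUnder_eq]
  refine ⟨⟨(s * c)⁻¹, by simpa using ⟨hs0, hc0⟩, hPSL⟩, r₀, hr₀, fun E hE hEm => ?_⟩
  rw [hPSL, Measure.smul_apply, smul_eq_mul, hhaar E hE hEm, ← mul_assoc,
    ENNReal.inv_mul_cancel hsc0 hsct, one_mul]

instance isMulLeftInvariant_haarPSL (b : Module.Basis (Fin 3) ℝ sl2) :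
    (haarPSL b).IsMulLeftInvariant := by
  obtain ⟨⟨a, -, ha⟩, -⟩ := exists_haarPSL_eq b
  rw [ha]
  infer_instance

instance sigmaFinite_haarPSL (b : Module.Basis (Fin 3) ℝ sl2) : SigmaFinite (haarPSL b) := by
  obtain ⟨⟨a, hat, ha⟩, -⟩ := exists_haarPSL_eq b
  rw [ha]
  lift a to NNReal using hat
  exact inferInstanceAs (SigmaFinite (a • (Measure.haar : Measure PSL(2, ℝ))))

/-- Near the identity, the Haar measure in exponential coordinates is at most `1 + O(r)` times
Lebesgue measure. -/
theorem exists_lintegral_haarPSL_le (b : Module.Basis (Fin 3) ℝ sl2) :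
    ∃ C : ℝ, 0 < C ∧ ∃ r₀ : ℝ, 0 < r₀ ∧ ∀ r, 0 ≤ r → r ≤ r₀ →
      MeasurableSet (expChart b '' Metric.closedBall 0 r) ∧
      ∀ F : E3 → ℝ≥0∞, Measurable F →
        ∫⁻ x in expChart b '' Metric.closedBall 0 r, F (logChart b x) ∂(haarPSL b)
          ≤ ENNReal.ofReal (1 + C * r) * ∫⁻ x, F x := by
  obtain ⟨-, r₁, hr₁, himg⟩ := exists_haarPSL_eq b
  obtain ⟨C, hC, r₂, hr₂, hbound, hvol⟩ := exists_chartMap_bounds b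
  obtain ⟨r₃, hr₃, hlog, hlogexp⟩ := exists_logChart_expChart b
  refine ⟨C, hC, min r₁ (min r₂ r₃), by positivity, fun r hr0 hr => ?_⟩
  have hrr₁ : r ≤ r₁ := hr.trans (min_le_left _ _)
  have hrr₂ : r ≤ r₂ := hr.trans ((min_le_right _ _).trans (min_le_left _ _))
  have hrr₃ : r ≤ r₃ := hr.trans ((min_le_right _ _).trans (min_le_right _ _))
  set B := Metric.closedBall (0 : E3) r with hB
  have hBlog : ∀ x ∈ B, toSl b x ∈ logTarget := fun x hx =>
    hlog x ((mem_closedBall_zero_iff.1 hx).trans hrr₃)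
  have hmeas : ∀ E ⊆ B, MeasurableSet E → MeasurableSet (expChart b '' E) := fun E hE hEm =>
    hEm.image_of_continuousOn_injOn (continuous_expChart b).continuousOn
      ((expChart_injOn b).mono fun x hx => hBlog x (hE hx))
  have hBm : MeasurableSet (expChart b '' B) := hmeas B subset_rfl measurableSet_closedBall
  refine ⟨hBm, fun F hF => ?_⟩
  -- Domination of measures, checked on sets, gives the inequality for all `F` at once.
  have hle : Measure.map (logChart b) ((haarPSL b).restrict (expChart b '' B))
      ≤ ENNReal.ofReal (1 + C * r) • volume := by
    refine Measure.le_iff.2 fun E hE => ?_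
    have hset : logChart b ⁻¹' E ∩ expChart b '' B = expChart b '' (E ∩ B) := by
      ext g
      constructor
      · rintro ⟨hg, x, hx, rfl⟩
        rw [Set.mem_preimage, hlogexp x ((mem_closedBall_zero_iff.1 hx).trans hrr₃)] at hg
        exact ⟨x, ⟨hg, hx⟩, rfl⟩
      · rintro ⟨x, ⟨hxE, hxB⟩, rfl⟩
        refine ⟨?_, x, hxB, rfl⟩
        rwa [Set.mem_preimage, hlogexp x ((mem_closedBall_zero_iff.1 hxB).trans hrr₃)]
    have hEB : MeasurableSet (E ∩ B) := hE.inter measurableSet_closedBall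
    have hsub : ∀ {ρ : ℝ}, r ≤ ρ → E ∩ B ⊆ Metric.closedBall 0 ρ := fun h =>
      Set.inter_subset_right.trans (Metric.closedBall_subset_closedBall h)
    rw [Measure.map_apply (measurable_logChart b) hE,
      Measure.restrict_apply (measurable_logChart b hE), hset, himg _ (hsub hrr₁) hEB,
      hvol _ (hsub hrr₂) hEB, Measure.smul_apply, smul_eq_mul]
    calc ∫⁻ x in E ∩ B, chartJac b x
        ≤ ∫⁻ _ in E ∩ B, ENNReal.ofReal (1 + C * r) := by
          refine setLIntegral_mono' hEB fun x hx => ?_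
          have hxr : ‖x‖ ≤ r := mem_closedBall_zero_iff.1 hx.2
          exact (hbound x (hxr.trans hrr₂)).trans (ENNReal.ofReal_le_ofReal (by gcongr))
      _ = ENNReal.ofReal (1 + C * r) * volume (E ∩ B) := setLIntegral_const _ _
      _ ≤ ENNReal.ofReal (1 + C * r) * volume E := by gcongr; exact Set.inter_subset_left
  calc ∫⁻ x in expChart b '' B, F (logChart b x) ∂(haarPSL b)
      = ∫⁻ y, F y ∂(Measure.map (logChart b) ((haarPSL b).restrict (expChart b '' B))) :=
        (lintegral_map hF (measurable_logChart b)).symm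
    _ ≤ ∫⁻ y, F y ∂(ENNReal.ofReal (1 + C * r) • volume) := lintegral_mono' hle le_rfl
    _ = ENNReal.ofReal (1 + C * r) * ∫⁻ x, F x := by rw [lintegral_smul_measure, smul_eq_mul]

/-! ### The entropy inequality -/

section Entropy

variable {G : Type*} [Group G] [MeasurableSpace G] [MeasurableMul₂ G]

/-- Only an inequality, since the density times its inverse is `0` instead of `1` where the density
is `0` or `∞`. -/
theorem lintegral_mul_inv_rnDeriv_le {α : Type*} [MeasurableSpace α] {μ ν : Measure α}
    [SigmaFinite μ] [SigmaFinite ν] (h : μ ≪ ν) {F : α → ℝ≥0∞} (hF : Measurable F) :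
    ∫⁻ x, F x * (μ.rnDeriv ν x)⁻¹ ∂μ ≤ ∫⁻ x, F x ∂ν := by
  have hm := Measure.measurable_rnDeriv μ ν
  calc ∫⁻ x, F x * (μ.rnDeriv ν x)⁻¹ ∂μ
      = ∫⁻ x, F x * (μ.rnDeriv ν x)⁻¹ ∂(ν.withDensity (μ.rnDeriv ν)) := by
        rw [Measure.withDensity_rnDeriv_eq μ ν h]
    _ = ∫⁻ x, (μ.rnDeriv ν * fun x => F x * (μ.rnDeriv ν x)⁻¹) x ∂ν :=
        lintegral_withDensity_eq_lintegral_mul _ hm (hF.mul hm.inv)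
    _ ≤ ∫⁻ x, F x ∂ν := by
        refine lintegral_mono fun x => ?_
        simp only [Pi.mul_apply]
        calc μ.rnDeriv ν x * (F x * (μ.rnDeriv ν x)⁻¹)
            = F x * (μ.rnDeriv ν x * (μ.rnDeriv ν x)⁻¹) := by ring
          _ ≤ F x * 1 := by gcongr; exact ENNReal.mul_inv_le_one _
          _ = F x := mul_one _

/-- Given `g`, the product is a left translate of `s`, and left translates of null sets are null. -/
theorem map_mul_absolutelyContinuous {Ω : Type*} [MeasurableSpace Ω] {P : Measure Ω}
    [IsProbabilityMeasure P] {m : Measure G} [SigmaFinite m] [m.IsMulLeftInvariant]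
    {g s : Ω → G} (hg : Measurable g) (hs : Measurable s) (hind : IndepFun g s P)
    (hac : P.map s ≪ m) : P.map (fun ω => g ω * s ω) ≪ m := by
  have hpg := Measure.isProbabilityMeasure_map (μ := P) hg.aemeasurable
  have hps := Measure.isProbabilityMeasure_map (μ := P) hs.aemeasurable
  refine Measure.AbsolutelyContinuous.mk fun N hN hN0 => ?_
  have h1 : P.map (fun ω => g ω * s ω) = ((P.map g).prod (P.map s)).map fun p => p.1 * p.2 := by
    rw [← (indepFun_iff_map_prod_eq_prod_map_map hg.aemeasurable hs.aemeasurable).1 hind,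
      Measure.map_map measurable_mul (hg.prodMk hs)]
    rfl
  rw [h1, Measure.map_apply measurable_mul hN, Measure.prod_apply (measurable_mul hN)]
  refine (lintegral_congr fun x => ?_).trans lintegral_zero
  refine hac ?_
  have : Prod.mk x ⁻¹' ((fun p : G × G => p.1 * p.2) ⁻¹' N) = (fun y => x * y) ⁻¹' N := rfl
  rw [this, measure_preimage_mul, hN0]

/-- The change of variables behind the entropy inequality: each inverse density turns a law into
Haar measure. Integrating over `s₂` cancels its density, and left invariance turns `g s₂` into a
variable `y₂` with weight `h₂`, independent of `g`. What remains depends on `g` and `s₁` only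
through `y₁`, whose density cancels too. By Tonelli the mass bound on `q(y₂, ·)` then applies for
each `y₂`. -/
theorem lintegral_density_ratio_le {Ω : Type*} [MeasurableSpace Ω] {P : Measure Ω}
    [IsProbabilityMeasure P] {m : Measure G} [SigmaFinite m] [m.IsMulLeftInvariant]
    {g s₁ s₂ : Ω → G} (hg : Measurable g) (hs₁ : Measurable s₁) (hs₂ : Measurable s₂)
    (hind : IndepFun g (fun ω => (s₁ ω, s₂ ω)) P) (hind' : IndepFun s₁ s₂ P)
    (hac₁ : P.map s₁ ≪ m) (hac₂ : P.map s₂ ≪ m) {q : G × G → ℝ≥0∞} (hq : Measurable q)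
    {c : ℝ≥0∞} (hqc : ∀ y₂, ∫⁻ y₁, q (y₂, y₁) ∂m ≤ c) :
    ∫⁻ ω, q (g ω * s₂ ω, g ω * s₁ ω)
        * (P.map fun ω => g ω * s₂ ω).rnDeriv m (g ω * s₂ ω)
        * ((P.map fun ω => g ω * s₁ ω).rnDeriv m (g ω * s₁ ω))⁻¹
        * ((P.map s₂).rnDeriv m (s₂ ω))⁻¹ ∂P ≤ c := by
  have hpg := Measure.isProbabilityMeasure_map (μ := P) hg.aemeasurable
  have hp₁ := Measure.isProbabilityMeasure_map (μ := P) hs₁.aemeasurable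
  have hp₂ := Measure.isProbabilityMeasure_map (μ := P) hs₂.aemeasurable
  have hy₁ : Measurable fun ω => g ω * s₁ ω := hg.mul hs₁
  have hy₂ : Measurable fun ω => g ω * s₂ ω := hg.mul hs₂
  have hpy₁ := Measure.isProbabilityMeasure_map (μ := P) hy₁.aemeasurable
  have hpy₂ := Measure.isProbabilityMeasure_map (μ := P) hy₂.aemeasurable
  set ρ₁ := P.map fun ω => g ω * s₁ ω with hρ₁
  set ρ₂ := P.map fun ω => g ω * s₂ ω with hρ₂
  set h₁ := ρ₁.rnDeriv m with hh₁
  set h₂ := ρ₂.rnDeriv m with hh₂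
  set f₂ := (P.map s₂).rnDeriv m with hf₂
  have mh₁ : Measurable h₁ := Measure.measurable_rnDeriv _ _
  have mh₂ : Measurable h₂ := Measure.measurable_rnDeriv _ _
  have mf₂ : Measurable f₂ := Measure.measurable_rnDeriv _ _
  have hind₁ : IndepFun g s₁ P := hind.comp measurable_id measurable_fst
  set Φ : G → ℝ≥0∞ := fun y₁ => ∫⁻ y₂, q (y₂, y₁) ∂ρ₂ with hΦ
  have mΦ : Measurable Φ := hq.lintegral_prod_left'
  let F : G × G × G → ℝ≥0∞ := fun p => q (p.1 * p.2.2, p.1 * p.2.1) * h₂ (p.1 * p.2.2)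
    * (h₁ (p.1 * p.2.1))⁻¹ * (f₂ p.2.2)⁻¹
  have mF : Measurable F := by
    have m1 : Measurable fun p : G × G × G => p.1 * p.2.1 :=
      measurable_fst.mul (measurable_fst.comp measurable_snd)
    have m2 : Measurable fun p : G × G × G => p.1 * p.2.2 :=
      measurable_fst.mul (measurable_snd.comp measurable_snd)
    exact (((hq.comp (m2.prodMk m1)).mul (mh₂.comp m2)).mul (mh₁.comp m1).inv).mul
      (mf₂.comp (measurable_snd.comp measurable_snd)).inv
  have hlaw : P.map (fun ω => (g ω, s₁ ω, s₂ ω))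
      = (P.map g).prod ((P.map s₁).prod (P.map s₂)) := by
    rw [← (indepFun_iff_map_prod_eq_prod_map_map hs₁.aemeasurable hs₂.aemeasurable).1 hind']
    exact (indepFun_iff_map_prod_eq_prod_map_map hg.aemeasurable
      (hs₁.prodMk hs₂).aemeasurable).1 hind
  have hlaw₁ : ρ₁ = ((P.map g).prod (P.map s₁)).map fun p => p.1 * p.2 := by
    rw [← (indepFun_iff_map_prod_eq_prod_map_map hg.aemeasurable hs₁.aemeasurable).1 hind₁,
      Measure.map_map measurable_mul (hg.prodMk hs₁)]
    rfl
  have inner : ∀ x y₁ : G, ∫⁻ s, q (x * s, y₁) * h₂ (x * s) * (f₂ s)⁻¹ ∂(P.map s₂) ≤ Φ y₁ := by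
    intro x y₁
    have mq : Measurable fun y => q (y, y₁) := hq.comp (measurable_id.prodMk measurable_const)
    have mx : Measurable fun s => q (x * s, y₁) * h₂ (x * s) :=
      (mq.mul mh₂).comp (measurable_const_mul x)
    calc ∫⁻ s, q (x * s, y₁) * h₂ (x * s) * (f₂ s)⁻¹ ∂(P.map s₂)
        ≤ ∫⁻ s, q (x * s, y₁) * h₂ (x * s) ∂m := lintegral_mul_inv_rnDeriv_le hac₂ mx
      _ = ∫⁻ y, q (y, y₁) * h₂ y ∂m := lintegral_mul_left_eq_self (fun y => q (y, y₁) * h₂ y) x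
      _ = ∫⁻ y, q (y, y₁) ∂(m.withDensity h₂) := by
          rw [lintegral_withDensity_eq_lintegral_mul _ mh₂ mq]
          simp only [Pi.mul_apply, mul_comm]
      _ ≤ Φ y₁ := lintegral_mono' (Measure.withDensity_rnDeriv_le _ _) le_rfl
  calc ∫⁻ ω, F (g ω, s₁ ω, s₂ ω) ∂P
      = ∫⁻ p, F p ∂((P.map g).prod ((P.map s₁).prod (P.map s₂))) := by
        rw [← hlaw, lintegral_map mF (hg.prodMk (hs₁.prodMk hs₂))]
    _ = ∫⁻ x, ∫⁻ t, ∫⁻ s, F (x, t, s) ∂(P.map s₂) ∂(P.map s₁) ∂(P.map g) := by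
        rw [lintegral_prod _ mF.aemeasurable]
        refine lintegral_congr fun x => ?_
        exact lintegral_prod _ (mF.comp (measurable_const.prodMk measurable_id)).aemeasurable
    _ ≤ ∫⁻ x, ∫⁻ t, Φ (x * t) * (h₁ (x * t))⁻¹ ∂(P.map s₁) ∂(P.map g) := by
        refine lintegral_mono fun x => lintegral_mono fun t => ?_
        have e : ∀ s, F (x, t, s)
            = (h₁ (x * t))⁻¹ * (q (x * s, x * t) * h₂ (x * s) * (f₂ s)⁻¹) := by
          intro s
          simp only [F]
          ring
        simp only [e]
        have ms : Measurable fun s => q (x * s, x * t) * h₂ (x * s) * (f₂ s)⁻¹ :=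
          ((hq.comp ((measurable_const_mul x).prodMk measurable_const)).mul
            (mh₂.comp (measurable_const_mul x))).mul mf₂.inv
        rw [lintegral_const_mul _ ms, mul_comm]
        gcongr
        exact inner x (x * t)
    _ = ∫⁻ y, Φ y * (h₁ y)⁻¹ ∂ρ₁ := by
        have mm : Measurable fun y => Φ y * (h₁ y)⁻¹ := mΦ.mul mh₁.inv
        rw [hlaw₁, lintegral_map mm measurable_mul]
        exact (lintegral_prod (fun z : G × G => Φ (z.1 * z.2) * (h₁ (z.1 * z.2))⁻¹)
          (mm.comp measurable_mul).aemeasurable).symm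
    _ ≤ ∫⁻ y, Φ y ∂m :=
        lintegral_mul_inv_rnDeriv_le (map_mul_absolutelyContinuous hg hs₁ hind₁ hac₁) mΦ
    _ = ∫⁻ y₂, ∫⁻ y₁, q (y₂, y₁) ∂m ∂ρ₂ :=
        lintegral_lintegral_swap (hq.comp measurable_swap).aemeasurable
    _ ≤ ∫⁻ _, c ∂ρ₂ := lintegral_mono hqc
    _ = c := by simp

/-- Integrate `log Z ≤ Z - 1` for the ratio `Z` of `lintegral_density_ratio_le`; finite entropy
permits splitting `log Z` into separately integrable terms. This is Gibbs' inequality for `y₁` given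
`y₂` combined with `H(y₁, y₂) ≥ H(y₁) + H(s₂)`. -/
theorem integral_log_density_le {Ω : Type*} [MeasurableSpace Ω] {P : Measure Ω}
    [IsProbabilityMeasure P] {m : Measure G} [SigmaFinite m] [m.IsMulLeftInvariant]
    {g s₁ s₂ : Ω → G} (hg : Measurable g) (hs₁ : Measurable s₁) (hs₂ : Measurable s₂)
    (hind : IndepFun g (fun ω => (s₁ ω, s₂ ω)) P) (hind' : IndepFun s₁ s₂ P)
    (hac₁ : P.map s₁ ≪ m) (hac₂ : P.map s₂ ≪ m)
    (hi₂ : Integrable (fun x => Real.log ((P.map s₂).rnDeriv m x).toReal) (P.map s₂))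
    (hj₁ : Integrable (fun x => Real.log ((P.map fun ω => g ω * s₁ ω).rnDeriv m x).toReal)
      (P.map fun ω => g ω * s₁ ω))
    (hj₂ : Integrable (fun x => Real.log ((P.map fun ω => g ω * s₂ ω).rnDeriv m x).toReal)
      (P.map fun ω => g ω * s₂ ω))
    {q : G × G → ℝ≥0∞} (hq : Measurable q) {c : ℝ} (hc : 0 ≤ c)
    (hqc : ∀ y₂, ∫⁻ y₁, q (y₂, y₁) ∂m ≤ ENNReal.ofReal c)
    (hq0 : ∀ᵐ ω ∂P, q (g ω * s₂ ω, g ω * s₁ ω) ≠ 0)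
    (hqt : ∀ᵐ ω ∂P, q (g ω * s₂ ω, g ω * s₁ ω) ≠ ∞)
    (hqi : Integrable (fun ω => Real.log (q (g ω * s₂ ω, g ω * s₁ ω)).toReal) P) :
    ∫ ω, Real.log (q (g ω * s₂ ω, g ω * s₁ ω)).toReal ∂P
      + ∫ x, Real.log ((P.map fun ω => g ω * s₂ ω).rnDeriv m x).toReal
          ∂(P.map fun ω => g ω * s₂ ω)
      - ∫ x, Real.log ((P.map fun ω => g ω * s₁ ω).rnDeriv m x).toReal
          ∂(P.map fun ω => g ω * s₁ ω)
      - ∫ x, Real.log ((P.map s₂).rnDeriv m x).toReal ∂(P.map s₂) ≤ c - 1 := by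
  have hpg := Measure.isProbabilityMeasure_map (μ := P) hg.aemeasurable
  have hp₂ := Measure.isProbabilityMeasure_map (μ := P) hs₂.aemeasurable
  have hy₁ : Measurable fun ω => g ω * s₁ ω := hg.mul hs₁
  have hy₂ : Measurable fun ω => g ω * s₂ ω := hg.mul hs₂
  have hpy₁ := Measure.isProbabilityMeasure_map (μ := P) hy₁.aemeasurable
  have hpy₂ := Measure.isProbabilityMeasure_map (μ := P) hy₂.aemeasurable
  have hlint := lintegral_density_ratio_le hg hs₁ hs₂ hind hind' hac₁ hac₂ hq hqc
  have hr₁ : (P.map fun ω => g ω * s₁ ω) ≪ m := map_mul_absolutelyContinuous hg hs₁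
    (hind.comp measurable_id measurable_fst) hac₁
  have hr₂ : (P.map fun ω => g ω * s₂ ω) ≪ m := map_mul_absolutelyContinuous hg hs₂
    (hind.comp measurable_id measurable_snd) hac₂
  have pos : ∀ {y : Ω → G}, Measurable y → P.map y ≪ m →
      ∀ᵐ ω ∂P, 0 < (P.map y).rnDeriv m (y ω) ∧ (P.map y).rnDeriv m (y ω) ≠ ∞ := by
    intro y hy hac
    have hpy := Measure.isProbabilityMeasure_map (μ := P) hy.aemeasurable
    exact ae_of_ae_map hy.aemeasurable
      ((Measure.rnDeriv_pos hac).and (hac.ae_le (Measure.rnDeriv_ne_top _ _)))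
  have pull : ∀ {y : Ω → G}, Measurable y →
      Integrable (fun x => Real.log ((P.map y).rnDeriv m x).toReal) (P.map y) →
      Integrable (fun ω => Real.log ((P.map y).rnDeriv m (y ω)).toReal) P ∧
      ∫ x, Real.log ((P.map y).rnDeriv m x).toReal ∂(P.map y)
        = ∫ ω, Real.log ((P.map y).rnDeriv m (y ω)).toReal ∂P := fun hy hi =>
    ⟨hi.comp_measurable hy, integral_map hy.aemeasurable hi.aestronglyMeasurable⟩
  obtain ⟨i₂, e₂⟩ := pull hs₂ hi₂
  obtain ⟨k₁, e₃⟩ := pull hy₁ hj₁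
  obtain ⟨k₂, e₄⟩ := pull hy₂ hj₂
  set Z : Ω → ℝ≥0∞ := fun ω => q (g ω * s₂ ω, g ω * s₁ ω)
        * (P.map fun ω => g ω * s₂ ω).rnDeriv m (g ω * s₂ ω)
        * ((P.map fun ω => g ω * s₁ ω).rnDeriv m (g ω * s₁ ω))⁻¹
        * ((P.map s₂).rnDeriv m (s₂ ω))⁻¹ with hZ
  have mZ : Measurable Z :=
    (((hq.comp (hy₂.prodMk hy₁)).mul ((Measure.measurable_rnDeriv _ _).comp hy₂)).mul
      ((Measure.measurable_rnDeriv _ _).comp hy₁).inv).mul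
      ((Measure.measurable_rnDeriv _ _).comp hs₂).inv
  have hZi : Integrable (fun ω => (Z ω).toReal) P :=
    integrable_toReal_of_lintegral_ne_top mZ.aemeasurable
      (hlint.trans_lt ENNReal.ofReal_lt_top).ne
  have hZle : ∫ ω, (Z ω).toReal ∂P ≤ c := by
    rw [integral_toReal mZ.aemeasurable
      (ae_lt_top mZ (hlint.trans_lt ENNReal.ofReal_lt_top).ne)]
    exact ENNReal.toReal_le_of_le_ofReal hc hlint
  rw [e₂, e₃, e₄, ← integral_add' hqi k₂, ← integral_sub' (hqi.add k₂) k₁,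
    ← integral_sub' ((hqi.add k₂).sub k₁) i₂]
  calc _ ≤ ∫ ω, ((Z ω).toReal - 1) ∂P := by
        refine integral_mono_ae (((hqi.add k₂).sub k₁).sub i₂) (hZi.sub (integrable_const 1)) ?_
        filter_upwards [hq0, hqt, pos hs₂ hac₂, pos hy₁ hr₁, pos hy₂ hr₂] with ω w0 wt w₂ v₁ v₂
        have p0 := (ENNReal.toReal_pos w0 wt).ne'
        have p₂ := (ENNReal.toReal_pos w₂.1.ne' w₂.2).ne'
        have r₁ := (ENNReal.toReal_pos v₁.1.ne' v₁.2).ne'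
        have r₂ := (ENNReal.toReal_pos v₂.1.ne' v₂.2).ne'
        have hlog : Real.log (Z ω).toReal = Real.log (q (g ω * s₂ ω, g ω * s₁ ω)).toReal
            + Real.log ((P.map fun ω => g ω * s₂ ω).rnDeriv m (g ω * s₂ ω)).toReal
            - Real.log ((P.map fun ω => g ω * s₁ ω).rnDeriv m (g ω * s₁ ω)).toReal
            - Real.log ((P.map s₂).rnDeriv m (s₂ ω)).toReal := by
          simp only [hZ, ENNReal.toReal_mul, ENNReal.toReal_inv]
          rw [Real.log_mul (by positivity) (by positivity),
            Real.log_mul (by positivity) (by positivity), Real.log_mul p0 r₂,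
            Real.log_inv, Real.log_inv]
          ring
        have hZpos : 0 < (Z ω).toReal := by
          simp only [hZ, ENNReal.toReal_mul, ENNReal.toReal_inv]
          positivity
        have := Real.log_le_sub_one_of_pos hZpos
        rw [hlog] at this
        exact this
    _ ≤ c - 1 := by
        rw [integral_sub hZi (integrable_const 1)]
        simpa using hZle

theorem integrable_log_of_hasFiniteEntropy (b : Module.Basis (Fin 3) ℝ sl2)
    {μ : Measure PSL(2, ℝ)} [IsProbabilityMeasure μ] (hac : μ ≪ haarPSL b)
    (h : HasFiniteEntropy b μ) :
    Integrable (fun x => Real.log (μ.rnDeriv (haarPSL b) x).toReal) μ := by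
  have hm : Measurable fun x => Real.log (μ.rnDeriv (haarPSL b) x).toReal :=
    (Measure.measurable_rnDeriv _ _).ennreal_toReal.log
  have h1 : Integrable (fun x => |Real.log (μ.rnDeriv (haarPSL b) x).toReal|) μ :=
    (integrable_rnDeriv_smul_iff hac).1 h
  exact (integrable_norm_iff hm.aestronglyMeasurable).1 h1

end Entropy

/-! ### Conditional variance -/

section CondVar

variable {Ω β γ : Type*} [MeasurableSpace Ω] [MeasurableSpace β] [MeasurableSpace γ]
  [StandardBorelSpace γ] [Nonempty γ] {P : Measure Ω} [IsFiniteMeasure P]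

theorem measurable_integral_condDistrib {X : Ω → γ} {Y : Ω → β} {f : β × γ → ℝ}
    (hf : Measurable f) :
    Measurable fun y => ∫ x, f (y, x) ∂(condDistrib X Y P y) :=
  (hf.stronglyMeasurable.integral_kernel_prod_right' (κ := condDistrib X Y P)).measurable

theorem abs_integral_condDistrib_le {X : Ω → γ} {Y : Ω → β} (hX : Measurable X)
    (hY : Measurable Y) {f : β × γ → ℝ} (hf : Measurable f) {R : ℝ}
    (hR : ∀ᵐ ω ∂P, |f (Y ω, X ω)| ≤ R) :
    ∀ᵐ ω ∂P, |∫ x, f (Y ω, x) ∂(condDistrib X Y P (Y ω))| ≤ R := by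
  have hS : MeasurableSet {p : β × γ | |f p| ≤ R} := measurableSet_le hf.abs measurable_const
  have h1 : ∀ᵐ p ∂(P.map fun ω => (Y ω, X ω)), |f p| ≤ R :=
    (ae_map_iff (hY.prodMk hX).aemeasurable hS).2 hR
  rw [← compProd_map_condDistrib hX.aemeasurable] at h1
  have h2 := Measure.ae_ae_of_ae_compProd h1
  filter_upwards [ae_of_ae_map hY.aemeasurable h2] with ω hω
  have h3 := norm_integral_le_of_norm_le_const (μ := condDistrib X Y P (Y ω))
    (f := fun x => f (Y ω, x)) (C := R) hω
  simpa using h3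

/-- Disintegrate the joint law of `(Y, X)` along `Y`. The almost sure bound on `f` makes the squared
deviation from the conditional mean bounded, hence integrable. -/
theorem integral_condVar {X : Ω → γ} {Y : Ω → β} (hX : Measurable X)
    (hY : Measurable Y) {f : β × γ → ℝ} (hf : Measurable f) {R : ℝ}
    (hR : ∀ᵐ ω ∂P, |f (Y ω, X ω)| ≤ R) :
    Integrable (fun ω => cov[fun x => f (Y ω, x), fun x => f (Y ω, x);
      condDistrib X Y P (Y ω)]) P ∧
    ∫ ω, cov[fun x => f (Y ω, x), fun x => f (Y ω, x); condDistrib X Y P (Y ω)] ∂P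
      = ∫ ω, (f (Y ω, X ω) - ∫ x, f (Y ω, x) ∂(condDistrib X Y P (Y ω))) ^ 2 ∂P := by
  set α : β → ℝ := fun y => ∫ x, f (y, x) ∂(condDistrib X Y P y) with hα
  have mα : Measurable α := measurable_integral_condDistrib hf
  have hαR := abs_integral_condDistrib_le hX hY hf hR
  set F : β × γ → ℝ := fun p => (f p - α p.1) * (f p - α p.1) with hF
  have mF : Measurable F :=
    (hf.sub (mα.comp measurable_fst)).mul (hf.sub (mα.comp measurable_fst))
  have hFi : Integrable (fun ω => F (Y ω, X ω)) P := by
    refine Integrable.of_bound (mF.comp (hY.prodMk hX)).aestronglyMeasurable ((2 * R) * (2 * R)) ?_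
    filter_upwards [hR, hαR] with ω h1 h2
    have h3 : |f (Y ω, X ω) - α (Y ω)| ≤ 2 * R := (abs_sub _ _).trans (by linarith)
    rw [hF, Real.norm_eq_abs, abs_mul]
    exact mul_le_mul h3 h3 (abs_nonneg _) ((abs_nonneg _).trans h3)
  have hFm : Integrable F (P.map fun ω => (Y ω, X ω)) :=
    (integrable_map_measure mF.aestronglyMeasurable (hY.prodMk hX).aemeasurable).2 hFi
  refine ⟨hFm.integral_condDistrib hY.aemeasurable hX.aemeasurable, ?_⟩
  have hFm' := hFm
  rw [← compProd_map_condDistrib hX.aemeasurable] at hFm'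
  have h1 := Measure.integral_compProd hFm'
  rw [compProd_map_condDistrib hX.aemeasurable,
    integral_map (hY.prodMk hX).aemeasurable mF.aestronglyMeasurable,
    integral_map hY.aemeasurable
      (measurable_integral_condDistrib mF).aestronglyMeasurable] at h1
  simp only [sq]
  exact h1.symm

end CondVar

/-! ### The Gaussian density -/

theorem lintegral_gaussian {β : ℝ} (hβ : 0 < β) (a : E3) :
    ∫⁻ x : E3, ENNReal.ofReal ((β / Real.pi) ^ (3 / 2 : ℝ) * Real.exp (-β * ‖x - a‖ ^ 2)) = 1 := by
  have h1 := GaussianFourier.integral_rexp_neg_mul_sq_norm (V := E3) hβ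
  rw [finrank_euclideanSpace_fin] at h1
  have hpos : 0 < (Real.pi / β) ^ ((3 : ℕ) / 2 : ℝ) := by positivity
  -- Integrability is read off from the positive value of the integral, since a non-integrable
  -- function has integral `0` by convention.
  have hint : Integrable fun x : E3 => Real.exp (-β * ‖x‖ ^ 2) := by
    by_contra hn
    rw [integral_undef hn] at h1
    exact hpos.ne h1
  rw [lintegral_sub_right_eq_self
    (fun x : E3 => ENNReal.ofReal ((β / Real.pi) ^ (3 / 2 : ℝ) * Real.exp (-β * ‖x‖ ^ 2))) a,
    ← ofReal_integral_eq_lintegral_ofReal (hint.const_mul _)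
      (Eventually.of_forall fun x => by positivity), integral_const_mul, h1,
    show ((3 : ℕ) / 2 : ℝ) = 3 / 2 by norm_num,
    ← Real.mul_rpow (by positivity) (by positivity)]
  have : β / Real.pi * (Real.pi / β) = 1 := by
    field_simp
  rw [this, Real.one_rpow, ENNReal.ofReal_one]

/-! ### Small elements of the group -/

/-- Writing `s₁ = exp x₁` and `s₂ = exp x₂` with `x₁`, `x₂` of size `O(ε)`, this is the approximate
addition law for `-x₂` and `x₁`. The bound on `ε` keeps all three exponents where the logarithm
inverts exp. -/
theorem exists_logChart_bounds (b e : Module.Basis (Fin 3) ℝ sl2) :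
    ∃ K : ℝ, 0 < K ∧ ∃ ε₀ : ℝ, 0 < ε₀ ∧ ∀ ε, 0 < ε → ε ≤ ε₀ → ∀ s₁ s₂ : PSL(2, ℝ),
      riemannDist e 1 s₁ ≤ ENNReal.ofReal ε → riemannDist e 1 s₂ ≤ ENNReal.ofReal ε →
      ‖logChart b s₁‖ ≤ K * ε ∧ ‖logChart b s₂⁻¹‖ ≤ K * ε ∧
      s₂⁻¹ * s₁ ∈ expChart b '' Metric.closedBall 0 (K * ε) ∧
      ‖logChart b (s₂⁻¹ * s₁) - (logChart b s₂⁻¹ + logChart b s₁)‖ ≤ K * ε ^ 2 := by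
  obtain ⟨K₁, hK₁, ε₁, hε₁, hdist⟩ := exists_expChart_eq_of_riemannDist_le b e
  obtain ⟨K₂, hK₂, r₂, hr₂, hmul⟩ := exists_expSL_mul b
  obtain ⟨r₃, hr₃, -, hlog⟩ := exists_logChart_expChart b
  refine ⟨K₁ + K₂ * K₁ + K₂ * K₁ ^ 2, by positivity,
    min (min ε₁ (r₂ / K₁)) (min (r₃ / K₁) (r₃ / (K₂ * K₁))), by positivity,
    fun ε hε hε₀ s₁ s₂ h₁ h₂ => ?_⟩
  have e1 : ε ≤ ε₁ := hε₀.trans ((min_le_left _ _).trans (min_le_left _ _))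
  have e2 : K₁ * ε ≤ r₂ := by
    have := hε₀.trans ((min_le_left _ _).trans (min_le_right _ _))
    rw [le_div_iff₀ hK₁] at this
    linarith
  have e3 : K₁ * ε ≤ r₃ := by
    have := hε₀.trans ((min_le_right _ _).trans (min_le_left _ _))
    rw [le_div_iff₀ hK₁] at this
    linarith
  have e4 : K₂ * (K₁ * ε) ≤ r₃ := by
    have := hε₀.trans ((min_le_right _ _).trans (min_le_right _ _))
    rw [le_div_iff₀ (by positivity)] at this
    linarith
  obtain ⟨x₁, hx₁, rfl⟩ := hdist ε hε e1 s₁ h₁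
  obtain ⟨x₂, hx₂, rfl⟩ := hdist ε hε e1 s₂ h₂
  have hx₂' : ‖-x₂‖ ≤ K₁ * ε := by rwa [norm_neg]
  obtain ⟨z, hz, hz1, hz2⟩ := hmul (K₁ * ε) (by positivity) e2 (-x₂) x₁ hx₂' hx₁
  have hz' : expChart b (-x₂) * expChart b x₁ = expChart b z := by
    rw [expChart_eq_mk, expChart_eq_mk, expChart_eq_mk, ← QuotientGroup.mk_mul, hz]
  have p1 : 0 < K₂ * K₁ * ε := by positivity
  have p2 : 0 < K₂ * K₁ ^ 2 * ε := by positivity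
  have p3 : 0 < K₁ * ε := by positivity
  rw [← expChart_neg, hz', hlog x₁ (hx₁.trans e3), hlog (-x₂) (hx₂'.trans e3),
    hlog z (hz1.trans e4)]
  refine ⟨by linarith, by linarith, ⟨z, mem_closedBall_zero_iff.2 (by linarith), rfl⟩,
    hz2.trans ?_⟩
  have p4 : 0 < K₂ * K₁ * ε ^ 2 := by positivity
  have p5 : 0 < K₁ * ε ^ 2 := by positivity
  linarith

/-! ### The variance of a product -/

/-- If `U - A` is uncorrelated with `W - M`, then the second moment of a perturbation of
`(U - A) + (W - M)` is almost additive. -/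
theorem integral_norm_sq_le_of_near_sum {Ω : Type*} [MeasurableSpace Ω] {P : Measure Ω}
    [IsProbabilityMeasure P] {U W T A : Ω → E3} {M : E3} {R D : ℝ}
    (hU : Measurable U) (hW : Measurable W) (hT : Measurable T) (hA : Measurable A)
    (hUR : ∀ᵐ ω ∂P, ∀ i, |U ω i| ≤ R) (hWR : ∀ᵐ ω ∂P, ∀ i, |W ω i| ≤ R)
    (hAR : ∀ᵐ ω ∂P, ∀ i, |A ω i| ≤ R) (hM : ∀ i, M i = ∫ ω, W ω i ∂P)
    (hTD : ∀ᵐ ω ∂P, ‖T ω - (U ω + W ω)‖ ≤ D)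
    (hind : IndepFun (fun ω => U ω - A ω) W P) :
    Integrable (fun ω => ‖T ω - (A ω + M)‖ ^ 2) P ∧
    ∫ ω, ‖T ω - (A ω + M)‖ ^ 2 ∂P
      ≤ ∑ i, ∫ ω, (U ω i - A ω i) ^ 2 ∂P + ∑ i, ∫ ω, (W ω i - M i) ^ 2 ∂P
        + (24 * R * D + D ^ 2) := by
  have mc : ∀ {V : Ω → E3}, Measurable V → ∀ i, Measurable fun ω => V ω i := fun hV i =>
    (EuclideanSpace.proj (𝕜 := ℝ) i).continuous.measurable.comp hV
  have hMR : ∀ i, |M i| ≤ R := by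
    intro i
    rw [hM i]
    have := norm_integral_le_of_norm_le_const (μ := P) (f := fun ω => W ω i) (C := R)
      (hWR.mono fun ω h => h i)
    simpa using this
  have i1 : ∀ i, Integrable (fun ω => (U ω i - A ω i) ^ 2) P := by
    intro i
    refine Integrable.of_bound (((mc hU i).sub (mc hA i)).pow_const 2).aestronglyMeasurable
      ((2 * R) ^ 2) ?_
    filter_upwards [hUR, hAR] with ω h1 h2
    rw [Real.norm_eq_abs, abs_pow]
    gcongr
    exact (abs_sub _ _).trans (by linarith [h1 i, h2 i])
  have i2 : ∀ i, Integrable (fun ω => (W ω i - M i) ^ 2) P := by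
    intro i
    refine Integrable.of_bound (((mc hW i).sub_const _).pow_const 2).aestronglyMeasurable
      ((2 * R) ^ 2) ?_
    filter_upwards [hWR] with ω h1
    rw [Real.norm_eq_abs, abs_pow]
    gcongr
    exact (abs_sub _ _).trans (by linarith [h1 i, hMR i])
  have i3 : ∀ i, Integrable (fun ω => U ω i - A ω i) P := by
    intro i
    refine Integrable.of_bound ((mc hU i).sub (mc hA i)).aestronglyMeasurable (2 * R) ?_
    filter_upwards [hUR, hAR] with ω h1 h2
    exact (abs_sub _ _).trans (by linarith [h1 i, h2 i])
  have i4 : ∀ i, Integrable (fun ω => W ω i) P := by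
    intro i
    refine Integrable.of_bound (mc hW i).aestronglyMeasurable R ?_
    filter_upwards [hWR] with ω h1
    exact h1 i
  have i5 : ∀ i, Integrable (fun ω => W ω i - M i) P := fun i => (i4 i).sub (integrable_const _)
  have hcoord : ∀ i, IndepFun (fun ω => U ω i - A ω i) (fun ω => W ω i - M i) P := by
    intro i
    have mi : Measurable fun v : E3 => v i :=
      (EuclideanSpace.proj (𝕜 := ℝ) i).continuous.measurable
    exact hind.comp (φ := fun v : E3 => v i) (ψ := fun v : E3 => v i - M i) mi (mi.sub_const _)
  have i6 : ∀ i, Integrable (fun ω => (U ω i - A ω i) * (W ω i - M i)) P := fun i =>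
    (hcoord i).integrable_mul (i3 i) (i5 i)
  -- Independence factors the integral, and `W - M` has mean zero.
  have hcross : ∀ i, ∫ ω, (U ω i - A ω i) * (W ω i - M i) ∂P = 0 := by
    intro i
    have h1 := (hcoord i).integral_mul_eq_mul_integral (i3 i).aestronglyMeasurable
      (i5 i).aestronglyMeasurable
    have h2 : ∫ ω, (W ω i - M i) ∂P = 0 := by
      rw [integral_sub (i4 i) (integrable_const _), hM i]
      simp
    rw [h2, mul_zero] at h1
    exact h1
  set B : Ω → ℝ := fun ω => ∑ i, (U ω i - A ω i) ^ 2 + ∑ i, (W ω i - M i) ^ 2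
      + 2 * ∑ i, (U ω i - A ω i) * (W ω i - M i) + (24 * R * D + D ^ 2) with hB
  have s1 : Integrable (fun ω => ∑ i, (U ω i - A ω i) ^ 2) P :=
    integrable_finsetSum _ fun i _ => i1 i
  have s2 : Integrable (fun ω => ∑ i, (W ω i - M i) ^ 2) P :=
    integrable_finsetSum _ fun i _ => i2 i
  have s3 : Integrable (fun ω => 2 * ∑ i, (U ω i - A ω i) * (W ω i - M i)) P :=
    (integrable_finsetSum _ fun i _ => i6 i).const_mul 2
  have hBi : Integrable B P := ((s1.add s2).add s3).add (integrable_const _)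
  have hle : ∀ᵐ ω ∂P, ‖T ω - (A ω + M)‖ ^ 2 ≤ B ω := by
    filter_upwards [hUR, hWR, hAR, hTD] with ω h1 h2 h3 h4
    have hD : 0 ≤ D := (norm_nonneg _).trans h4
    set p := (U ω - A ω) + (W ω - M) with hp
    -- Three coordinates of size at most `4 * R` each; the cross term `2 * ‖p‖ * D` thus costs `24 *
    -- R * D`.
    have hpn : ‖p‖ ≤ 12 * R := by
      have hb : ∀ v : E3, ‖v‖ ≤ ∑ i, |v i| := fun v => by
        rw [EuclideanSpace.norm_eq]
        refine Real.sqrt_le_iff.2 ⟨by positivity, ?_⟩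
        have := Finset.sum_sq_le_sq_sum_of_nonneg (s := Finset.univ) (f := fun i => |v i|)
          (fun i _ => abs_nonneg _)
        simpa using this
      refine (hb p).trans ?_
      have h5 : ∀ i, |p i| ≤ 4 * R := by
        intro i
        have : p i = (U ω i - A ω i) + (W ω i - M i) := rfl
        rw [this]
        refine (abs_add_le _ _).trans ?_
        have a1 := abs_sub (U ω i) (A ω i)
        have a2 := abs_sub (W ω i) (M i)
        linarith [h1 i, h2 i, h3 i, hMR i]
      calc ∑ i, |p i| ≤ ∑ _i : Fin 3, 4 * R := Finset.sum_le_sum fun i _ => h5 i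
        _ = 12 * R := by simp; ring
    have hsplit : T ω - (A ω + M) = p + (T ω - (U ω + W ω)) := by
      rw [hp]
      abel
    have hn : ‖T ω - (A ω + M)‖ ≤ ‖p‖ + D := by
      rw [hsplit]
      exact (norm_add_le _ _).trans (by linarith)
    have hp2 : ‖p‖ ^ 2 = ∑ i, (U ω i - A ω i) ^ 2 + ∑ i, (W ω i - M i) ^ 2
        + 2 * ∑ i, (U ω i - A ω i) * (W ω i - M i) := by
      rw [EuclideanSpace.norm_sq_eq, Finset.mul_sum, ← Finset.sum_add_distrib,
        ← Finset.sum_add_distrib]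
      refine Finset.sum_congr rfl fun i _ => ?_
      have : p i = (U ω i - A ω i) + (W ω i - M i) := rfl
      rw [this, Real.norm_eq_abs, sq_abs]
      ring
    have h6 : ‖T ω - (A ω + M)‖ ^ 2 ≤ (‖p‖ + D) ^ 2 := by gcongr
    have h7 : ‖p‖ * D ≤ 12 * R * D := by gcongr
    rw [hB]
    simp only
    rw [← hp2]
    nlinarith
  have hTi : Integrable (fun ω => ‖T ω - (A ω + M)‖ ^ 2) P := by
    refine Integrable.mono' hBi
      ((hT.sub (hA.add_const M)).norm.pow_const 2).aestronglyMeasurable ?_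
    filter_upwards [hle] with ω h
    rwa [Real.norm_eq_abs, abs_of_nonneg (by positivity)]
  refine ⟨hTi, (integral_mono_ae hTi hBi hle).trans (le_of_eq ?_)⟩
  have e1 : ∫ ω, B ω ∂P = ∫ ω, (∑ i, (U ω i - A ω i) ^ 2) ∂P + ∫ ω, (∑ i, (W ω i - M i) ^ 2) ∂P
      + ∫ ω, 2 * ∑ i, (U ω i - A ω i) * (W ω i - M i) ∂P + ∫ _, (24 * R * D + D ^ 2) ∂P := by
    rw [← integral_add' s1 s2, ← integral_add' (s1.add s2) s3,
      ← integral_add' ((s1.add s2).add s3) (integrable_const _)]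
    rfl
  rw [e1, integral_finsetSum _ fun i _ => i1 i, integral_finsetSum _ fun i _ => i2 i,
    integral_const_mul, integral_finsetSum _ fun i _ => i6 i]
  simp [hcross]

/-! ### The main estimate -/

/-- Left invariance moves `y` to the identity, where the Lebesgue comparison reduces the claim to
the total mass `1` of the Gaussian. -/
theorem lintegral_gaussian_translate_le {b : Module.Basis (Fin 3) ℝ sl2} {S : Set PSL(2, ℝ)}
    (hS : MeasurableSet S) {c : ℝ≥0∞}
    (hc : ∀ F : E3 → ℝ≥0∞, Measurable F →
      ∫⁻ x in S, F (logChart b x) ∂(haarPSL b) ≤ c * ∫⁻ x, F x)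
    {β : ℝ} (hβ : 0 < β) (a : E3) (y : PSL(2, ℝ)) :
    ∫⁻ x, S.indicator (fun z => ENNReal.ofReal ((β / Real.pi) ^ (3 / 2 : ℝ)
      * Real.exp (-β * ‖logChart b z - a‖ ^ 2))) (y⁻¹ * x) ∂(haarPSL b) ≤ c := by
  rw [lintegral_mul_left_eq_self (fun x => S.indicator (fun z => ENNReal.ofReal
    ((β / Real.pi) ^ (3 / 2 : ℝ) * Real.exp (-β * ‖logChart b z - a‖ ^ 2))) x) y⁻¹,
    lintegral_indicator hS]
  have hF : Measurable fun x : E3 => ENNReal.ofReal ((β / Real.pi) ^ (3 / 2 : ℝ)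
      * Real.exp (-β * ‖x - a‖ ^ 2)) := by fun_prop
  refine (hc _ hF).trans ?_
  rw [lintegral_gaussian hβ, mul_one]

theorem log_gaussian {β : ℝ} (hβ : 0 < β) (t : ℝ) :
    Real.log (ENNReal.ofReal ((β / Real.pi) ^ (3 / 2 : ℝ) * Real.exp (-β * t))).toReal
      = 3 / 2 * Real.log (β / Real.pi) - β * t := by
  have hp : 0 < β / Real.pi := by positivity
  rw [ENNReal.toReal_ofReal (by positivity), Real.log_mul (by positivity) (by positivity),
    Real.log_rpow hp, Real.log_exp]
  ring

/-- The entropy inequality with the Gaussian test density, for an arbitrary precision `β` still to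
be optimised. The quantity multiplied by `β` bounds the second moment of `log (s₂⁻¹ s₁)` about the
predicted centre. -/
theorem entropy_gap_le (b : Module.Basis (Fin 3) ℝ sl2) {Ω : Type*} [MeasurableSpace Ω]
    (P : Measure Ω) [IsProbabilityMeasure P] {g s₁ s₂ : Ω → PSL(2, ℝ)} (hg : Measurable g)
    (hs₁ : Measurable s₁) (hs₂ : Measurable s₂) (hind : iIndepFun ![g, s₁, s₂] P)
    (hac₁ : P.map s₁ ≪ haarPSL b) (hac₂ : P.map s₂ ≪ haarPSL b)
    (hf₂ : HasFiniteEntropy b (P.map s₂))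
    (hh₁ : HasFiniteEntropy b (P.map fun ω => g ω * s₁ ω))
    (hh₂ : HasFiniteEntropy b (P.map fun ω => g ω * s₂ ω))
    {S : Set PSL(2, ℝ)} (hS : MeasurableSet S) {c₀ : ℝ} (hc₀ : 0 ≤ c₀)
    (hc : ∀ F : E3 → ℝ≥0∞, Measurable F →
      ∫⁻ x in S, F (logChart b x) ∂(haarPSL b) ≤ ENNReal.ofReal c₀ * ∫⁻ x, F x)
    {R D : ℝ} (hs₁R : ∀ᵐ ω ∂P, ‖logChart b (s₁ ω)‖ ≤ R)
    (hs₂R : ∀ᵐ ω ∂P, ‖logChart b (s₂ ω)⁻¹‖ ≤ R)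
    (hmem : ∀ᵐ ω ∂P, (s₂ ω)⁻¹ * s₁ ω ∈ S)
    (hD : ∀ᵐ ω ∂P, ‖logChart b ((s₂ ω)⁻¹ * s₁ ω)
      - (logChart b (s₂ ω)⁻¹ + logChart b (s₁ ω))‖ ≤ D)
    {β : ℝ} (hβ : 0 < β) :
    Integrable (trCondVar b P (fun ω => g ω * s₂ ω) g (fun ω => g ω * s₂ ω)) P ∧
    3 / 2 * Real.log (β / Real.pi)
      - β * (∫ ω, trCondVar b P (fun ω => g ω * s₂ ω) g (fun ω => g ω * s₂ ω) ω ∂P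
          + (varAt b 1 (P.map s₁)).trace + (24 * R * D + D ^ 2))
      - entropy b (P.map fun ω => g ω * s₂ ω) + entropy b (P.map fun ω => g ω * s₁ ω)
      + entropy b (P.map s₂) ≤ c₀ - 1 := by
  have hm : ∀ i, Measurable (![g, s₁, s₂] i) := by
    intro i
    fin_cases i <;> assumption
  have ind₁ : IndepFun g (fun ω => (s₁ ω, s₂ ω)) P :=
    (hind.indepFun_prodMk hm 1 2 0 (by decide) (by decide)).symm
  have ind₂ : IndepFun s₁ s₂ P := hind.indepFun (i := 1) (j := 2) (by decide)
  have ind₃ : IndepFun (fun ω => (g ω, s₂ ω)) s₁ P :=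
    hind.indepFun_prodMk hm 0 2 1 (by decide) (by decide)
  have hy₁ : Measurable fun ω => g ω * s₁ ω := hg.mul hs₁
  have hy₂ : Measurable fun ω => g ω * s₂ ω := hg.mul hs₂
  have hp₂ := Measure.isProbabilityMeasure_map (μ := P) hs₂.aemeasurable
  have hpy₁ := Measure.isProbabilityMeasure_map (μ := P) hy₁.aemeasurable
  have hpy₂ := Measure.isProbabilityMeasure_map (μ := P) hy₂.aemeasurable
  have mlog := measurable_logChart b
  have mi : ∀ i, Measurable fun v : E3 => v i := fun i =>
    (EuclideanSpace.proj (𝕜 := ℝ) i).continuous.measurable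
  have norm_coord : ∀ (v : E3) (i : Fin 3), |v i| ≤ ‖v‖ := fun v i => by
    simpa using PiLp.norm_apply_le v i
  have mquot : Measurable fun p : PSL(2, ℝ) × PSL(2, ℝ) => p.1⁻¹ * p.2 :=
    measurable_fst.inv.mul measurable_snd
  -- Seen from `y₂ = g s₂`, the unknown `g` is `s₂⁻¹` and `g s₁` is `s₂⁻¹ s₁`; both are small, which
  -- makes logarithmic coordinates effective although `g` itself is unrestricted.
  have hU : ∀ ω, (g ω * s₂ ω)⁻¹ * g ω = (s₂ ω)⁻¹ := fun ω => by group
  have hT : ∀ ω, (g ω * s₂ ω)⁻¹ * (g ω * s₁ ω) = (s₂ ω)⁻¹ * s₁ ω := fun ω => by group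
  set f : Fin 3 → PSL(2, ℝ) × PSL(2, ℝ) → ℝ := fun i p => logChart b (p.1⁻¹ * p.2) i with hf
  have mf : ∀ i, Measurable (f i) := fun i => (mi i).comp (mlog.comp mquot)
  have hfR : ∀ i, ∀ᵐ ω ∂P, |f i (g ω * s₂ ω, g ω)| ≤ R := fun i => by
    filter_upwards [hs₂R] with ω h
    simp only [hf, hU]
    exact (norm_coord _ i).trans h
  have hcv := fun i => integral_condVar hg hy₂ (mf i) (hfR i)
  -- The conditional mean of `log (y₂⁻¹ g)` given `y₂ = y`: with this centre the mean squared
  -- deviation is exactly the conditional variance.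
  set α : PSL(2, ℝ) → E3 := fun y => WithLp.toLp 2 fun i =>
    ∫ x, f i (y, x) ∂(condDistrib g (fun ω => g ω * s₂ ω) P y) with hα
  have mα : Measurable α := (PiLp.continuous_toLp 2 fun _ : Fin 3 => ℝ).measurable.comp
    (measurable_pi_lambda _ fun i => measurable_integral_condDistrib (mf i))
  have hαR : ∀ᵐ ω ∂P, ∀ i, |α (g ω * s₂ ω) i| ≤ R :=
    ae_all_iff.2 fun i => abs_integral_condDistrib_le hg hy₂ (mf i) (hfR i)
  set M : E3 := WithLp.toLp 2 fun i => ∫ ω, logChart b (s₁ ω) i ∂P with hM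
  have htr : trCondVar b P (fun ω => g ω * s₂ ω) g (fun ω => g ω * s₂ ω)
      = fun ω => ∑ i, cov[fun x => f i (g ω * s₂ ω, x), fun x => f i (g ω * s₂ ω, x);
          condDistrib g (fun ω => g ω * s₂ ω) P (g ω * s₂ ω)] := rfl
  have htri : Integrable (trCondVar b P (fun ω => g ω * s₂ ω) g (fun ω => g ω * s₂ ω)) P := by
    rw [htr]
    exact integrable_finsetSum _ fun i _ => (hcv i).1
  have htre : ∫ ω, trCondVar b P (fun ω => g ω * s₂ ω) g (fun ω => g ω * s₂ ω) ω ∂P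
      = ∑ i, ∫ ω, (logChart b (s₂ ω)⁻¹ i - α (g ω * s₂ ω) i) ^ 2 ∂P := by
    rw [htr, integral_finsetSum _ fun i _ => (hcv i).1]
    refine Finset.sum_congr rfl fun i _ => (hcv i).2.trans ?_
    simp only [hf, hU]
    rfl
  have hvar : (varAt b 1 (P.map s₁)).trace = ∑ i, ∫ ω, (logChart b (s₁ ω) i - M i) ^ 2 ∂P := by
    refine Finset.sum_congr rfl fun i _ => ?_
    have e1 : ∫ x, logChart b x i ∂(P.map s₁) = M i :=
      integral_map hs₁.aemeasurable ((mi i).comp mlog).aestronglyMeasurable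
    have e2 : varAt b 1 (P.map s₁) i i
        = ∫ x, (logChart b x i - M i) ^ 2 ∂(P.map s₁) := by
      simp only [varAt, Matrix.of_apply, covariance, inv_one, one_mul, sq, ← e1]
      rfl
    rw [Matrix.diag_apply, e2]
    exact integral_map hs₁.aemeasurable
      ((((mi i).comp mlog).sub_const _).pow_const 2).aestronglyMeasurable
  refine ⟨htri, ?_⟩
  -- The deviation from the conditional mean is a function of `(g, s₂)`, which is independent of
  -- `s₁`.
  have hind₄ : IndepFun (fun ω => logChart b (s₂ ω)⁻¹ - α (g ω * s₂ ω))
      (fun ω => logChart b (s₁ ω)) P := by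
    have mφ : Measurable fun p : PSL(2, ℝ) × PSL(2, ℝ) => logChart b p.2⁻¹ - α (p.1 * p.2) :=
      (mlog.comp measurable_snd.inv).sub (mα.comp measurable_mul)
    exact ind₃.comp mφ mlog
  have hMi : ∀ i, M i = ∫ ω, logChart b (s₁ ω) i ∂P := fun i => rfl
  clear_value α M
  have hmoment := integral_norm_sq_le_of_near_sum (P := P)
    (U := fun ω => logChart b (s₂ ω)⁻¹) (W := fun ω => logChart b (s₁ ω))
    (T := fun ω => logChart b ((s₂ ω)⁻¹ * s₁ ω)) (A := fun ω => α (g ω * s₂ ω)) (M := M)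
    (R := R) (D := D) (mlog.comp hs₂.inv) (mlog.comp hs₁) (mlog.comp (hs₂.inv.mul hs₁))
    (mα.comp hy₂) (hs₂R.mono fun ω h i => (norm_coord _ i).trans h)
    (hs₁R.mono fun ω h i => (norm_coord _ i).trans h) hαR hMi hD hind₄
  -- The Gaussian is cut off to `S`, where Haar measure is controlled by Lebesgue measure; almost
  -- surely `y₂⁻¹ y₁` lies in `S`, so the cutoff does not affect `log q`.
  set q : PSL(2, ℝ) × PSL(2, ℝ) → ℝ≥0∞ := fun p => S.indicator (fun z =>
    ENNReal.ofReal ((β / Real.pi) ^ (3 / 2 : ℝ)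
      * Real.exp (-β * ‖logChart b z - (α p.1 + M)‖ ^ 2))) (p.1⁻¹ * p.2) with hq
  have mq : Measurable q := by
    have h1 : q = ((fun p : PSL(2, ℝ) × PSL(2, ℝ) => p.1⁻¹ * p.2) ⁻¹' S).indicator fun p =>
        ENNReal.ofReal ((β / Real.pi) ^ (3 / 2 : ℝ)
          * Real.exp (-β * ‖logChart b (p.1⁻¹ * p.2) - (α p.1 + M)‖ ^ 2)) := by
      funext p
      by_cases hp : p.1⁻¹ * p.2 ∈ S
      · rw [Set.indicator_of_mem (show p ∈ _ from hp)]
        exact Set.indicator_of_mem hp _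
      · rw [Set.indicator_of_notMem (show p ∉ _ from hp)]
        exact Set.indicator_of_notMem hp _
    rw [h1]
    refine Measurable.indicator ?_ (mquot hS)
    have h2 : Measurable fun p : PSL(2, ℝ) × PSL(2, ℝ) =>
        logChart b (p.1⁻¹ * p.2) - (α p.1 + M) :=
      (mlog.comp mquot).sub ((mα.comp measurable_fst).add_const M)
    exact ((((h2.norm.pow_const 2).const_mul (-β)).exp).const_mul _).ennreal_ofReal
  have hqval : ∀ᵐ ω ∂P, q (g ω * s₂ ω, g ω * s₁ ω)
      = ENNReal.ofReal ((β / Real.pi) ^ (3 / 2 : ℝ) * Real.exp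
        (-β * ‖logChart b ((s₂ ω)⁻¹ * s₁ ω) - (α (g ω * s₂ ω) + M)‖ ^ 2)) := by
    filter_upwards [hmem] with ω h
    simp only [hq, hT]
    exact Set.indicator_of_mem h _
  have hlogq : (fun ω => Real.log (q (g ω * s₂ ω, g ω * s₁ ω)).toReal) =ᵐ[P] fun ω =>
      3 / 2 * Real.log (β / Real.pi)
        - β * ‖logChart b ((s₂ ω)⁻¹ * s₁ ω) - (α (g ω * s₂ ω) + M)‖ ^ 2 := by
    filter_upwards [hqval] with ω h
    rw [h, log_gaussian hβ]
  have hmain := integral_log_density_le (m := haarPSL b) hg hs₁ hs₂ ind₁ ind₂ hac₁ hac₂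
    (integrable_log_of_hasFiniteEntropy b hac₂ hf₂)
    (integrable_log_of_hasFiniteEntropy b (map_mul_absolutelyContinuous hg hs₁
      (ind₁.comp measurable_id measurable_fst) hac₁) hh₁)
    (integrable_log_of_hasFiniteEntropy b (map_mul_absolutelyContinuous hg hs₂
      (ind₁.comp measurable_id measurable_snd) hac₂) hh₂)
    mq hc₀ (fun y₂ => lintegral_gaussian_translate_le hS hc hβ (α y₂ + M) y₂)
    (hqval.mono fun ω h => by
      rw [h]
      exact (ENNReal.ofReal_pos.2 (by positivity)).ne')
    (hqval.mono fun ω h => by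
      rw [h]
      exact ENNReal.ofReal_ne_top)
    (((integrable_const _).sub (hmoment.1.const_mul β)).congr hlogq.symm)
  rw [integral_congr_ae hlogq, integral_sub (integrable_const _) (hmoment.1.const_mul β),
    integral_const_mul β] at hmain
  simp only [integral_const, probReal_univ, one_smul] at hmain
  have hmul := mul_le_mul_of_nonneg_left hmoment.2 hβ.le
  rw [htre, hvar]
  unfold entropy
  linarith

end PSLVariance

/-! ### Choice of the Gaussian variance and of the constants -/

theorem theorem1p15 (b e : Module.Basis (Fin 3) ℝ PSLVariance.sl2) :
    ∃ ε₀ : ℝ, 0 < ε₀ ∧ ∀ A : ℝ, 0 < A → ∃ C : ℝ, 0 < C ∧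
      ∀ (Ω : Type*) [MeasurableSpace Ω] (P : Measure Ω) [IsProbabilityMeasure P]
        (g s₁ s₂ : Ω → PSL(2, ℝ)),
        Measurable g → Measurable s₁ → Measurable s₂ →
        iIndepFun ![g, s₁, s₂] P →
        P.map s₁ ≪ PSLVariance.haarPSL b →
        P.map s₂ ≪ PSLVariance.haarPSL b →
        PSLVariance.HasFiniteEntropy b (P.map s₁) →
        PSLVariance.HasFiniteEntropy b (P.map s₂) →
        PSLVariance.HasFiniteEntropy b (P.map (fun ω => g ω * s₁ ω)) →
        PSLVariance.HasFiniteEntropy b (P.map (fun ω => g ω * s₂ ω)) →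
        ∀ k c ε : ℝ,
          k = PSLVariance.entropy b (P.map (fun ω => g ω * s₁ ω))
              - PSLVariance.entropy b (P.map s₁)
              - PSLVariance.entropy b (P.map (fun ω => g ω * s₂ ω))
              + PSLVariance.entropy b (P.map s₂) →
          c = 3 / 2 * Real.log (2 / 3 * Real.pi * Real.exp 1
                * (PSLVariance.varAt b 1 (P.map s₁)).trace)
              - PSLVariance.entropy b (P.map s₁) →
          0 < k → 0 < ε → ε ≤ ε₀ →
          (∀ᵐ ω ∂P, PSLVariance.riemannDist e 1 (s₁ ω) ≤ ENNReal.ofReal ε) →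
          (∀ᵐ ω ∂P, PSLVariance.riemannDist e 1 (s₂ ω) ≤ ENNReal.ofReal ε) →
          A * ε ^ 2 ≤ (PSLVariance.varAt b 1 (P.map s₁)).trace →
          Integrable (PSLVariance.trCondVar b P (fun ω => g ω * s₂ ω) g
            (fun ω => g ω * s₂ ω)) P ∧
          2 / 3 * (k - c - C * ε) * (PSLVariance.varAt b 1 (P.map s₁)).trace
            ≤ ∫ ω, PSLVariance.trCondVar b P (fun ω => g ω * s₂ ω) g
                (fun ω => g ω * s₂ ω) ω ∂P := by
  obtain ⟨K, hK, ε₁, hε₁, hgeo⟩ := PSLVariance.exists_logChart_bounds b e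
  obtain ⟨C, hC, r₀, hr₀, hhaar⟩ := PSLVariance.exists_lintegral_haarPSL_le b
  -- The threshold comes from geometry alone and does not involve `A`. In the constant, `C * K` is
  -- the excess Gaussian mass over `1` per unit of `ε`, and the second term is the linearisation
  -- error relative to `V`.
  refine ⟨min ε₁ (r₀ / K), by positivity, fun A hA =>
    ⟨C * K + 3 / 2 * ((24 * K ^ 2 + K ^ 2 * ε₁) / A), by positivity, ?_⟩⟩
  intro Ω _ P _ g s₁ s₂ hg hs₁ hs₂ hind hac₁ hac₂ _ hf₂ hh₁ hh₂ k c ε hk hc _ hε hε₀ hd₁ hd₂ hAV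
  have hεε₁ : ε ≤ ε₁ := hε₀.trans (min_le_left _ _)
  have hKε : K * ε ≤ r₀ := by
    have := hε₀.trans (min_le_right _ _)
    rw [le_div_iff₀ hK] at this
    linarith
  have hgeo' := hd₁.and hd₂ |>.mono fun ω h => hgeo ε hε hεε₁ (s₁ ω) (s₂ ω) h.1 h.2
  obtain ⟨hS, hSle⟩ := hhaar (K * ε) (by positivity) hKε
  set V := (PSLVariance.varAt b 1 (P.map s₁)).trace with hV
  have hV0 : 0 < V := lt_of_lt_of_le (by positivity) hAV
  -- The precision `β = 3 / (2 * V)` means variance `V / 3` in each of three coordinates, so that `β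
  -- * V = 3 / 2` supplies the factor `e` inside the logarithm defining `c`.
  obtain ⟨hint, hmain⟩ := PSLVariance.entropy_gap_le b P hg hs₁ hs₂ hind hac₁ hac₂ hf₂ hh₁ hh₂ hS
    (c₀ := 1 + C * (K * ε)) (by positivity) hSle (R := K * ε) (D := K * ε ^ 2)
    (hgeo'.mono fun ω h => h.1) (hgeo'.mono fun ω h => h.2.1) (hgeo'.mono fun ω h => h.2.2.1)
    (hgeo'.mono fun ω h => h.2.2.2) (β := 3 / (2 * V)) (by positivity)
  refine ⟨hint, ?_⟩
  set I := ∫ ω, PSLVariance.trCondVar b P (fun ω => g ω * s₂ ω) g (fun ω => g ω * s₂ ω) ω ∂P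
  have hlog : Real.log (2 / 3 * Real.pi * Real.exp 1 * V)
      = 1 - Real.log (3 / (2 * V) / Real.pi) := by
    have h1 : 2 / 3 * Real.pi * Real.exp 1 * V = Real.exp 1 * (3 / (2 * V) / Real.pi)⁻¹ := by
      field_simp
    rw [h1, Real.log_mul (by positivity) (by positivity), Real.log_exp, Real.log_inv]
    ring
  set E := 24 * (K * ε) * (K * ε ^ 2) + (K * ε ^ 2) ^ 2 with hE
  -- The error is `O(ε³)`; the lower bound `A * ε ^ 2 ≤ V` trades two powers of `ε` for `V / A`.
  have hEle : E ≤ (24 * K ^ 2 + K ^ 2 * ε₁) / A * ε * V := by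
    have h1 : E ≤ (24 * K ^ 2 + K ^ 2 * ε₁) * ε * ε ^ 2 := by
      have h2 : K ^ 2 * ε ^ 3 * ε ≤ K ^ 2 * ε ^ 3 * ε₁ := by gcongr
      rw [hE]
      linarith
    have h3 : ε ^ 2 ≤ V / A := by
      rw [le_div_iff₀ hA]
      linarith
    calc E ≤ (24 * K ^ 2 + K ^ 2 * ε₁) * ε * ε ^ 2 := h1
      _ ≤ (24 * K ^ 2 + K ^ 2 * ε₁) * ε * (V / A) := by gcongr
      _ = (24 * K ^ 2 + K ^ 2 * ε₁) / A * ε * V := by ring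
  rw [hlog] at hc
  have hkc : k - c ≤ C * (K * ε) + 3 / (2 * V) * (I + E) := by
    have h1 : 3 / (2 * V) * (I + V + E) = 3 / 2 + 3 / (2 * V) * (I + E) := by
      field_simp
      ring
    rw [h1] at hmain
    linarith
  have hfin : 2 / 3 * (k - c) * V ≤ 2 / 3 * (C * (K * ε)) * V + (I + E) := by
    have h1 := mul_le_mul_of_nonneg_right hkc hV0.le
    have h2 : (C * (K * ε) + 3 / (2 * V) * (I + E)) * V
        = C * (K * ε) * V + 3 / 2 * (I + E) := by
      field_simp
    rw [h2] at h1
    linarith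
  linarith
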